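/- **Setting.** Let $Q,A,S$ be integers with $1\le A\le S$ and $A\le Q$. A time-slotted link has a buffer of size $Q$. The numbers of arriving packets $a[n]\in\{0,\dots,A\}$ form an irreducible Markov chain with transition probabilities $\gamma_{a,a'}$ and stationary law $\phi$; put $\alpha=\sum_a a\phi_a$. Transmitting $s\in\{0,\dots,S\}$ packets in a slot costs power $P(s)$, where $P(0)=0$ and $P$ is nondecreasing and convex. In queue length $q\in\{0,\dots,Q\}$ the feasible rates are $\mathcal S(q)=\{s:\max\{q-Q+A,0\}\le s\le\min\{q,S\}\}$, and the queue evolves as $q[n+1]=q[n]-s[n]+a[n+1]$. A policy $F=\{f_{q,a}^s\}$ uses rate $s$ in state $(q,a)$ with probability $f_{q,a}^s$, where $\sum_s f^s_{q,a}=1$ and $f_{q,a}^s=0$ for $s\notin\mathcal S(q)$; it is deterministic if for all $q,a$ some $f_{q,a}^s$ equals $1$. From an initial state $(q_0,a_0)$ it has the average power $P_F=\lim_N\frac1N\mathbb E\sum_{n=1}^N P(s[n])$ and the average delay $D_F=\lim_N\frac1N\mathbb E\sum_{n=1}^N\frac{q[n]}{\alpha}$. Let $\mathcal G$ be the set of state-action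 frequencies: all $x_{q,a}^s\ge 0$ with $x_{q,a}^s=0$ for $s\notin\mathcal S(q)$, $\sum_{q,a,s}x_{q,a}^s=1$ and, for all $q',a'$, $\sum_{q,a,s}\gamma_{a,a'}x_{q,a}^s\mathbf 1_{\{q'=q-s+a'\}}=\sum_s x_{q',a'}^s$. Let $\mathcal R$ be the set of all pairs $(P,D)=\bigl(\sum_{q,a,s} P(s)x_{q,a}^s,\ \frac1\alpha\sum_{q,a,s} q\,x_{q,a}^s\bigr)$, $x\in\mathcal G$, and let the optimal tradeoff curve be $$\mathcal L=\{(P^*,D^*)\in\mathcal R:\ \forall(\bar P,\bar D)\in\mathcal R,\ P^*\le\bar P\text{ or }D^*\le\bar D\}.$$ A vertex of $\mathcal L$ is an extreme point of the polygon $\mathcal R$ that lies on $\mathcal L$. **Theorem.** Let $(\hat P,\hat D)$ be a vertex of $\mathcal L$. (a) There is a deterministic policy $F^*$ such that 1. $F^*$ has a threshold structure: there are integers $q(s,a)$ with $q(-1,a)=-1$ and $0\le q(0,a)\le q(1,a)\le\dots\le q(S,a)\le Q$ for every $0\le a\le A$, such that ${f^*}_{q,a}^s=1$ if $q(s-1,a)<q\le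 q(s,a)$, and ${f^*}_{q,a}^s=0$ otherwise; 2. the Markov chain of the states $(q[n],a[n])$ under $F^*$ is a unichain, i.e. it has exactly one closed communicating class; 3. $(P_{F^*},D_{F^*})=(\hat P,\hat D)$ for every initial state; 4. for every $\mu>0$ for which $(\hat P,\hat D)$ minimizes $D+\mu P$ over $\mathcal R$, the policy $F^*$ solves the Lagrangian problem $\min_F D_F+\mu P_F$ over all policies $F$ (and all initial states). (b) If $\hat D$ is the least delay among the pairs $(P,D)\in\mathcal R$ with $P\le\hat P$, then there is a $\mu>0$ for which $(\hat P,\hat D)$ is the only minimizer of $D+\mu P$ over $\mathcal R$. -/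

import Mathlib

open Filter Topology

/-- A slotted link over a single-state (AWGN) channel: buffer size `Q`, arrivals in `{0,…,A}`
forming an irreducible Markov chain with transition matrix `γ` and stationary law `φ`,
transmission rates in `{0,…,S}`, and power consumption `power s` at rate `s`. -/
structure LinkModel (Q A S : ℕ) where
  γ : Matrix (Fin (A + 1)) (Fin (A + 1)) ℝ
  γ_nonneg : ∀ a a', 0 ≤ γ a a'
  γ_sum : ∀ a, ∑ a', γ a a' = 1
  γ_irreducible : γ.IsIrreducible
  φ : Fin (A + 1) → ℝ
  φ_nonneg : ∀ a, 0 ≤ φ a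
  φ_sum : ∑ a, φ a = 1
  φ_stationary : ∀ a', ∑ a, φ a * γ a a' = φ a'
  /-- Some packets do arrive. -/
  A_pos : 0 < A
  A_le_S : A ≤ S
  /-- Needed for a full buffer to have a feasible rate. -/
  A_le_Q : A ≤ Q
  power : Fin (S + 1) → ℝ
  power_zero : power 0 = 0
  power_mono : Monotone power
  /-- Discrete convexity: increments are nondecreasing. -/
  power_convex : ∀ i j k : Fin (S + 1), (j : ℕ) = i + 1 → (k : ℕ) = j + 1 →
    power j - power i ≤ power k - power j

namespace LinkModel

variable {Q A S : ℕ}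

/-- System states `(q, a)`: queue length and number of arrivals of the current slot. -/
abbrev State (Q A : ℕ) : Type := Fin (Q + 1) × Fin (A + 1)

/-- `s` belongs to the feasible region `max {q - Q + A, 0} ≤ s ≤ min {q, S}`
(written without subtraction; `s ≤ S` holds by type). -/
def Feasible (A : ℕ) (q : Fin (Q + 1)) (s : Fin (S + 1)) : Prop :=
  (q : ℕ) + A ≤ s + Q ∧ (s : ℕ) ≤ q

/-- Queue evolution `min {max {q - s, 0} + a', Q}`; subtraction in `ℕ` is `max {q - s, 0}`. -/
def nextQueue (q : Fin (Q + 1)) (s : Fin (S + 1)) (a' : Fin (A + 1)) : Fin (Q + 1) :=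
  ⟨min ((q : ℕ) - s + a') Q, Nat.lt_succ_of_le (min_le_right _ _)⟩

/-- A (randomized, stationary) transmission policy: `f q a s` is the probability of using rate `s`
in state `(q, a)`; only feasible rates get positive probability. -/
structure Policy (Q A S : ℕ) where
  f : Fin (Q + 1) → Fin (A + 1) → Fin (S + 1) → ℝ
  nonneg : ∀ q a s, 0 ≤ f q a s
  sum_one : ∀ q a, ∑ s, f q a s = 1
  feasible : ∀ q a s, ¬ Feasible A q s → f q a s = 0

/-- In every state, some rate is used with probability one. -/
def Policy.IsDeterministic (F : Policy Q A S) : Prop :=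
  ∀ q a, ∃ s, F.f q a s = 1

/-- `th s a` for `-1 ≤ s ≤ S` are thresholds describing `F`:
`-1 = th (-1) a`, `0 ≤ th 0 a ≤ th 1 a ≤ … ≤ th S a ≤ Q`, and rate `s` is used in state `(q, a)`
exactly when `th (s - 1) a < q ≤ th s a`. -/
def Policy.HasThresholds (F : Policy Q A S) (th : ℤ → Fin (A + 1) → ℤ) : Prop :=
  (∀ a, th (-1) a = -1 ∧ 0 ≤ th 0 a ∧ th S a ≤ Q ∧
    ∀ s : ℤ, 0 ≤ s → s < S → th s a ≤ th (s + 1) a) ∧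
  ∀ (q : Fin (Q + 1)) (a : Fin (A + 1)) (s : Fin (S + 1)),
    ((th (((s : ℕ) : ℤ) - 1) a < (q : ℕ) ∧ ((q : ℕ) : ℤ) ≤ th (s : ℕ) a) → F.f q a s = 1) ∧
    (¬ (th (((s : ℕ) : ℤ) - 1) a < (q : ℕ) ∧ ((q : ℕ) : ℤ) ≤ th (s : ℕ) a) → F.f q a s = 0)

/-- Expected number of arrivals per slot. -/
noncomputable def α (M : LinkModel Q A S) : ℝ := ∑ a : Fin (A + 1), ((a : ℕ) : ℝ) * M.φ a

/-- Transition matrix of the state process under a policy: entry `x y` is the probability of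
moving from `x` to `y`. -/
noncomputable def trans (M : LinkModel Q A S) (F : Policy Q A S) :
    Matrix (State Q A) (State Q A) ℝ :=
  fun x y => ∑ s : Fin (S + 1),
    M.γ x.2 y.2 * F.f x.1 x.2 s * (if y.1 = nextQueue x.1 s y.2 then 1 else 0)

/-- `(1/N) E_x^F [∑_{n=1}^N P(s[n])]`. -/
noncomputable def meanPower (M : LinkModel Q A S) (F : Policy Q A S) (x : State Q A) (N : ℕ) : ℝ :=
  (1 / (N : ℝ)) * ∑ n ∈ Finset.Icc 1 N, ∑ y : State Q A,
    (M.trans F ^ n) x y * ∑ s : Fin (S + 1), M.power s * F.f y.1 y.2 s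

/-- `(1/N) E_x^F [(1/α) ∑_{n=1}^N q[n]]`. -/
noncomputable def meanDelay (M : LinkModel Q A S) (F : Policy Q A S) (x : State Q A) (N : ℕ) : ℝ :=
  (1 / (N : ℝ)) * ∑ n ∈ Finset.Icc 1 N, ∑ y : State Q A,
    (M.trans F ^ n) x y * ((1 / M.α) * ((y.1 : ℕ) : ℝ))

/-- Started in `x`, policy `F` has long-term average power `p.1` and average delay `p.2`. -/
def HasAverages (M : LinkModel Q A S) (F : Policy Q A S) (x : State Q A) (p : ℝ × ℝ) : Prop :=
  Tendsto (M.meanPower F x) atTop (𝓝 p.1) ∧ Tendsto (M.meanDelay F x) atTop (𝓝 p.2)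

/-- `F` minimizes `D + μ P` among all policies, whatever the initial states. -/
def IsLagrangeOptimal (M : LinkModel Q A S) (μ : ℝ) (F : Policy Q A S) : Prop :=
  ∀ (x : State Q A) (p : ℝ × ℝ), M.HasAverages F x p →
    ∀ (G : Policy Q A S) (y : State Q A) (p' : ℝ × ℝ), M.HasAverages G y p' →
      p.2 + μ * p.1 ≤ p'.2 + μ * p'.1

/-- `y` can be reached from `x` under `F` with positive probability. -/
def Reaches (M : LinkModel Q A S) (F : Policy Q A S) : State Q A → State Q A → Prop :=
  Relation.ReflTransGen fun x y => 0 < M.trans F x y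

/-- `C` is a closed communicating class: it is nonempty, and from each of its members exactly the
members of `C` are reachable. -/
def IsClosedClass (M : LinkModel Q A S) (F : Policy Q A S) (C : Set (State Q A)) : Prop :=
  C.Nonempty ∧ ∀ x ∈ C, ∀ y, y ∈ C ↔ M.Reaches F x y

/-- The Markov chain under `F` has exactly one closed communicating class. -/
def IsUnichain (M : LinkModel Q A S) (F : Policy Q A S) : Prop :=
  ∃! C : Set (State Q A), M.IsClosedClass F C

/-- State-action frequencies: probability vectors on state-rate triples, carried by feasible
rates, that satisfy the balance equations. -/
def frequencies (M : LinkModel Q A S) : Set (Fin (Q + 1) → Fin (A + 1) → Fin (S + 1) → ℝ) :=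
  {x | (∀ q a s, 0 ≤ x q a s) ∧ (∀ q a s, ¬ Feasible A q s → x q a s = 0) ∧
    (∑ q, ∑ a, ∑ s, x q a s = 1) ∧
    ∀ (q' : Fin (Q + 1)) (a' : Fin (A + 1)),
      ∑ q, ∑ a, ∑ s, M.γ a a' * x q a s * (if q' = nextQueue q s a' then 1 else 0)
        = ∑ s, x q' a' s}

/-- The set `ℛ` of obtainable pairs (average power, average delay). -/
def region (M : LinkModel Q A S) : Set (ℝ × ℝ) :=
  {p | ∃ x ∈ M.frequencies,
    p.1 = ∑ q, ∑ a, ∑ s, M.power s * x q a s ∧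
    p.2 = (1 / M.α) * ∑ q : Fin (Q + 1), ∑ a, ∑ s, ((q : ℕ) : ℝ) * x q a s}

/-- The optimal tradeoff curve `ℒ`. -/
def tradeoffCurve (M : LinkModel Q A S) : Set (ℝ × ℝ) :=
  {p | p ∈ M.region ∧ ∀ p' ∈ M.region, p.1 ≤ p'.1 ∨ p.2 ≤ p'.2}

/-- `v` is a vertex of the polygonal curve `ℒ`: a corner of the polygon `ℛ` lying on `ℒ`. -/
def IsVertex (M : LinkModel Q A S) (v : ℝ × ℝ) : Prop :=
  v ∈ M.tradeoffCurve ∧ v ∈ M.region.extremePoints ℝ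

end LinkModel

/-! A vertex `v` of the tradeoff curve is the unique minimizer over the region of some functional `m
P + c D` with `m ≥ 0`. Separating the region from the open quadrant below `v` gives a supporting
line with nonnegative weights. An extreme point of a polygon is exposed, and a slight tilt of that
line towards an exposing one makes the support strict. The tilt could make `m` negative only if `m =
0`; but then `v` has least delay, and the least delay, which is 1, is attained at a single point.
The sign of `c` is immaterial for (a). For (b) the tilt is chosen so that both weights become
positive.

For fixed `m`, `c`, dynamic programming on the packets left after transmission, together with the
current arrivals, gives `g`, `J` with `bellman J = J + g`, as a limit of discounted problems.
Pairing this equation with frequencies shows `g ≤ m P + c D` on the region, with equality at every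
stationary law of a policy using minimizing rates. By uniqueness of the minimizer all these laws
have averages `v`, so the time averages converge to `v` from every initial state. The same duality
makes the region the convex hull of finitely many points, one for each deterministic policy.

For `m ≥ 0` the rate cost is convex, so `J` is convex in the packets left. Then, with the largest
minimizing rate, both this rate and the remainder are nondecreasing in `q`. Monotone rates are
threshold rules. Moreover, two copies driven by the same arrivals keep their order and never move
apart. If there were two closed classes, copies started at a closest pair would stay at exactly that
distance, and their mean delays would differ: a contradiction. -/

/-! ### Discrete convexity -/

/-- Discrete convexity of a function on `{0, …, n - 1}`: increments are nondecreasing. -/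
def DiscreteConvex {n : ℕ} (f : Fin n → ℝ) : Prop :=
  ∀ i j k : Fin n, (j : ℕ) = i + 1 → (k : ℕ) = j + 1 → f j - f i ≤ f k - f j

/-- Moving the two arguments one step towards each other does not increase the sum of values. -/
theorem DiscreteConvex.exchange {n : ℕ} {f : Fin n → ℝ} (hf : DiscreteConvex f)
    {i i' j' j : Fin n} (hi : (i' : ℕ) = i + 1) (hj : (j : ℕ) = j' + 1) (hij : (i : ℕ) ≤ j') :
    f i' + f j' ≤ f i + f j := by
  obtain ⟨d, hd⟩ := Nat.exists_eq_add_of_le hij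
  induction d generalizing j' j with
  | zero =>
    have h1 : j' = i := Fin.ext (by omega)
    have h2 : j = i' := Fin.ext (by omega)
    subst h1 h2
    linarith
  | succ d ih =>
    have h := ih (j' := ⟨i + d, by omega⟩) (j := j') (by simp; omega) (by simp) rfl
    have h2 := hf ⟨i + d, by omega⟩ j' j (by simp; omega) hj
    linarith

/-! ### Irreducible arrivals -/

namespace LinkModel

variable {Q A S : ℕ} (M : LinkModel Q A S)

theorem reflTransGen_arrivals (a b : Fin (A + 1)) :
    Relation.ReflTransGen (fun i j => 0 < M.γ i j) a b := by
  let := Matrix.toQuiver M.γ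
  obtain ⟨p, -⟩ := M.γ_irreducible.connected a b
  induction p with
  | nil => exact .refl
  | cons _ e ih => exact ih.tail e.down

theorem exists_arrival_predecessor (b : Fin (A + 1)) : ∃ a, 0 < M.γ a b := by
  let := Matrix.toQuiver M.γ
  obtain ⟨p, hp⟩ := M.γ_irreducible.connected b b
  cases p with
  | nil => simp at hp
  | cons _ e => exact ⟨_, e.down⟩

/-- Stationarity at a zero of `ψ` writes 0 as a sum of nonnegative terms, so zeros propagate
backwards along positive transitions. -/
theorem stationary_eq_zero {ψ : Fin (A + 1) → ℝ} (h0 : ∀ a, 0 ≤ ψ a)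
    (hst : ∀ a', ∑ a, ψ a * M.γ a a' = ψ a') {b : Fin (A + 1)} (hb : ψ b = 0) (a : Fin (A + 1)) :
    ψ a = 0 := by
  induction M.reflTransGen_arrivals a b using Relation.ReflTransGen.head_induction_on with
  | refl => exact hb
  | @head i j hij _ ih =>
    have h := hst j
    rw [ih, Finset.sum_eq_zero_iff_of_nonneg
      (fun k _ => mul_nonneg (h0 k) (M.γ_nonneg k j))] at h
    rcases mul_eq_zero.1 (h i (Finset.mem_univ i)) with h | h
    · exact h
    · exact absurd h hij.ne'

theorem φ_pos (a : Fin (A + 1)) : 0 < M.φ a := by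
  refine lt_of_le_of_ne (M.φ_nonneg a) fun h => ?_
  have hz := M.stationary_eq_zero M.φ_nonneg M.φ_stationary h.symm
  have := M.φ_sum
  simp [hz] at this

theorem α_pos : 0 < M.α := by
  have hA := M.A_pos
  refine Finset.sum_pos' (fun a _ => mul_nonneg (Nat.cast_nonneg _) (M.φ_nonneg a))
    ⟨Fin.last A, Finset.mem_univ _, mul_pos ?_ (M.φ_pos _)⟩
  simpa using hA

/-- The stationary law of the arrivals is unique. -/
theorem stationary_unique {ψ : Fin (A + 1) → ℝ} (h1 : ∑ a, ψ a = 1)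
    (hst : ∀ a', ∑ a, ψ a * M.γ a a' = ψ a') : ψ = M.φ := by
  obtain ⟨b, -, hb⟩ := Finset.exists_min_image Finset.univ (fun a => ψ a / M.φ a)
    Finset.univ_nonempty
  -- Subtracting the largest multiple of `φ` that stays below `ψ` leaves a nonnegative stationary
  -- vector with a zero.
  set r := ψ b / M.φ b with hr
  have hz := M.stationary_eq_zero (ψ := fun a => ψ a - r * M.φ a) (b := b)
    (fun a => by
      have h := hb a (Finset.mem_univ a)
      rw [le_div_iff₀ (M.φ_pos a)] at h
      linarith)
    (fun a' => by
      simp only [sub_mul, Finset.sum_sub_distrib, hst a', mul_assoc, ← Finset.mul_sum,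
        M.φ_stationary a'])
    (by have := (M.φ_pos b).ne'; simp only [hr]; field_simp; simp)
  have hψ : ∀ a, ψ a = r * M.φ a := fun a => sub_eq_zero.1 (hz a)
  have hr1 : r = 1 := by
    rw [Finset.sum_congr rfl fun a _ => hψ a, ← Finset.mul_sum, M.φ_sum, mul_one] at h1
    exact h1
  funext a
  rw [hψ a, hr1, one_mul]

/-! ### The average-cost optimality equation -/

/-- Queue length left after transmitting `s` packets out of `q`. -/
def post (A : ℕ) (q : Fin (Q + 1)) (s : Fin (S + 1)) : Fin (Q - A + 1) :=
  -- For feasible rates the truncation is vacuous: the lower bound on `s` says exactly that at most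
  -- `Q - A` packets stay.
  ⟨min (q - s) (Q - A), Nat.lt_succ_of_le (min_le_right _ _)⟩

/-- Queue length after `a` packets joined the `u` packets left over. -/
def arrive (u : Fin (Q - A + 1)) (a : Fin (A + 1)) : Fin (Q + 1) :=
  ⟨min (u + a) Q, Nat.lt_succ_of_le (min_le_right _ _)⟩

theorem post_val {q : Fin (Q + 1)} {s : Fin (S + 1)} (h : Feasible A q s) :
    (post A q s : ℕ) = q - s := by
  have := h.1; have := h.2
  simp only [post]; omega

theorem arrive_val (M : LinkModel Q A S) (u : Fin (Q - A + 1)) (a : Fin (A + 1)) :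
    (arrive u a : ℕ) = u + a := by
  have := M.A_le_Q
  simp only [arrive]; omega

theorem nextQueue_val {q : Fin (Q + 1)} {s : Fin (S + 1)} (h : Feasible A q s)
    (a : Fin (A + 1)) : (nextQueue q s a : ℕ) = q - s + a := by
  have := h.1; have := h.2
  simp only [nextQueue]; omega

theorem nextQueue_eq_arrive {q : Fin (Q + 1)} {s : Fin (S + 1)} (h : Feasible A q s)
    (a : Fin (A + 1)) : nextQueue q s a = arrive (post A q s) a := by
  have := h.1; have := h.2
  ext
  simp only [nextQueue, arrive, post]; omega

open Classical in
/-- The feasible rates at queue length `q`. -/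
noncomputable def rates (A S : ℕ) (q : Fin (Q + 1)) : Finset (Fin (S + 1)) :=
  Finset.univ.filter fun s => Feasible A q s

theorem mem_rates {q : Fin (Q + 1)} {s : Fin (S + 1)} : s ∈ rates A S q ↔ Feasible A q s := by
  simp [rates]

theorem rates_nonempty (M : LinkModel Q A S) (q : Fin (Q + 1)) : (rates A S q).Nonempty := by
  have := M.A_le_S; have := M.A_le_Q
  exact ⟨⟨min q S, by omega⟩, mem_rates.2 ⟨by simp; omega, by simp⟩⟩

/-- Least rate cost plus cost-to-go in state `(q, a)`, where `J` is the cost-to-go in terms of the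
packets left over. -/
noncomputable def best (κ : Fin (S + 1) → ℝ) (J : Fin (Q - A + 1) × Fin (A + 1) → ℝ)
    (q : Fin (Q + 1)) (a : Fin (A + 1)) : ℝ :=
  (rates A S q).inf' (M.rates_nonempty q) fun s => κ s + J (post A q s, a)

theorem best_le (κ : Fin (S + 1) → ℝ) (J : Fin (Q - A + 1) × Fin (A + 1) → ℝ)
    {q : Fin (Q + 1)} (a : Fin (A + 1)) {s : Fin (S + 1)} (h : Feasible A q s) :
    M.best κ J q a ≤ κ s + J (post A q s, a) :=
  Finset.inf'_le (fun s => κ s + J (post A q s, a)) (mem_rates.2 h)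

theorem exists_best_eq (κ : Fin (S + 1) → ℝ) (J : Fin (Q - A + 1) × Fin (A + 1) → ℝ)
    (q : Fin (Q + 1)) (a : Fin (A + 1)) :
    ∃ s, Feasible A q s ∧ M.best κ J q a = κ s + J (post A q s, a) := by
  obtain ⟨s, hs, h⟩ := Finset.exists_mem_eq_inf' (M.rates_nonempty q)
    fun s => κ s + J (post A q s, a)
  exact ⟨s, mem_rates.1 hs, h⟩

theorem best_le_best_add (κ : Fin (S + 1) → ℝ) {J J' : Fin (Q - A + 1) × Fin (A + 1) → ℝ} {d : ℝ}
    (h : ∀ x, J x ≤ J' x + d) (q : Fin (Q + 1)) (a : Fin (A + 1)) :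
    M.best κ J q a ≤ M.best κ J' q a + d := by
  obtain ⟨s, hs, e⟩ := M.exists_best_eq κ J' q a
  have := M.best_le κ J a hs
  have := h (post A q s, a)
  linarith

/-- The dynamic programming operator for the cost `κ s + c q` per slot, acting on functions of the
packets left over and the current arrivals. -/
noncomputable def bellman (κ : Fin (S + 1) → ℝ) (c : ℝ)
    (J : Fin (Q - A + 1) × Fin (A + 1) → ℝ) : Fin (Q - A + 1) × Fin (A + 1) → ℝ :=
  fun x => ∑ a', M.γ x.2 a' * (c * (arrive x.1 a' : ℕ) + M.best κ J (arrive x.1 a') a')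

/-- Monotonicity and compatibility with constants in one inequality; both nonexpansiveness in the
sup norm and `bellman_add_const` follow. -/
theorem bellman_le_add (κ : Fin (S + 1) → ℝ) (c : ℝ) {J J' : Fin (Q - A + 1) × Fin (A + 1) → ℝ}
    {d : ℝ} (h : ∀ x, J x ≤ J' x + d) (x) : M.bellman κ c J x ≤ M.bellman κ c J' x + d := by
  have hd : d = ∑ a', M.γ x.2 a' * d := by rw [← Finset.sum_mul, M.γ_sum, one_mul]
  rw [hd]
  simp only [bellman]
  rw [← Finset.sum_add_distrib]
  refine Finset.sum_le_sum fun a' _ => ?_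
  rw [← mul_add]
  refine mul_le_mul_of_nonneg_left ?_ (M.γ_nonneg _ _)
  have := M.best_le_best_add κ h (arrive x.1 a') a'
  linarith

theorem bellman_add_const (κ : Fin (S + 1) → ℝ) (c : ℝ) (J : Fin (Q - A + 1) × Fin (A + 1) → ℝ)
    (d : ℝ) (x) : M.bellman κ c (fun x => J x + d) x = M.bellman κ c J x + d := by
  refine le_antisymm (M.bellman_le_add κ c (fun x => le_rfl) x) ?_
  have := M.bellman_le_add κ c (J := J) (J' := fun x => J x + d) (d := -d)
    (fun x => by simp) x
  linarith

theorem dist_bellman_le (κ : Fin (S + 1) → ℝ) (c : ℝ) (J J') :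
    dist (M.bellman κ c J) (M.bellman κ c J') ≤ dist J J' := by
  rw [dist_pi_le_iff dist_nonneg]
  intro x
  rw [Real.dist_eq, abs_sub_le_iff]
  have h : ∀ K K' : Fin (Q - A + 1) × Fin (A + 1) → ℝ, ∀ x, K x ≤ K' x + dist K K' := by
    intro K K' x
    have := dist_le_pi_dist K K' x
    rw [Real.dist_eq, abs_sub_le_iff] at this
    linarith
  have h1 := M.bellman_le_add κ c (h J J') x
  have h2 := M.bellman_le_add κ c (h J' J) x
  rw [dist_comm J' J] at h2
  constructor <;> linarith

theorem continuous_bellman (κ : Fin (S + 1) → ℝ) (c : ℝ) : Continuous (M.bellman κ c) :=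
  (LipschitzWith.of_dist_le_mul (K := 1)
    (by simpa using M.dist_bellman_le κ c)).continuous

/-- Optimal rates at the two neighbours of `q` are turned into two rates at `q`. If the remainders
are strictly increasing, the rates are kept and the remainders move together, so convexity of `J`
applies. Otherwise the remainders are kept and the rates, at least two apart, move together, so
convexity of `κ` applies. -/
theorem discreteConvex_best {κ : Fin (S + 1) → ℝ} (hκ : DiscreteConvex κ)
    {J : Fin (Q - A + 1) × Fin (A + 1) → ℝ} {a : Fin (A + 1)}
    (hJ : DiscreteConvex fun u => J (u, a)) : DiscreteConvex fun q => M.best κ J q a := by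
  intro q₁ q q₂ h₁ h₂
  obtain ⟨s₁, hs₁, e₁⟩ := M.exists_best_eq κ J q₁ a
  obtain ⟨s₂, hs₂, e₂⟩ := M.exists_best_eq κ J q₂ a
  have f₁ := hs₁.1; have f₁' := hs₁.2
  have f₂ := hs₂.1; have f₂' := hs₂.2
  have hQ := M.A_le_Q
  rcases Nat.lt_or_ge ((q₁ : ℕ) - s₁) (q₂ - s₂) with h | h
  · have k₁ : Feasible A q s₁ := ⟨by omega, by omega⟩
    have k₂ : Feasible A q s₂ := ⟨by omega, by omega⟩
    have b₁ := M.best_le κ J a k₁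
    have b₂ := M.best_le κ J a k₂
    have := hJ.exchange (i := post A q₁ s₁) (i' := post A q s₁) (j' := post A q s₂)
      (j := post A q₂ s₂) (by rw [post_val k₁, post_val hs₁]; omega)
      (by rw [post_val k₂, post_val hs₂]; omega) (by rw [post_val k₂, post_val hs₁]; omega)
    linarith
  · obtain ⟨t₁, ht₁⟩ : ∃ t : Fin (S + 1), (t : ℕ) = s₁ + 1 := ⟨⟨s₁ + 1, by omega⟩, rfl⟩
    obtain ⟨t₂, ht₂⟩ : ∃ t : Fin (S + 1), (s₂ : ℕ) = t + 1 :=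
      ⟨⟨s₂ - 1, by omega⟩, by simp; omega⟩
    have k₁ : Feasible A q t₁ := ⟨by omega, by omega⟩
    have k₂ : Feasible A q t₂ := ⟨by omega, by omega⟩
    have b₁ := M.best_le κ J a k₁
    have b₂ := M.best_le κ J a k₂
    have p₁ : post A q t₁ = post A q₁ s₁ := Fin.ext (by rw [post_val k₁, post_val hs₁]; omega)
    have p₂ : post A q t₂ = post A q₂ s₂ := Fin.ext (by rw [post_val k₂, post_val hs₂]; omega)
    rw [p₁] at b₁
    rw [p₂] at b₂
    have := hκ.exchange ht₁ ht₂ (by omega)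
    linarith

/-- The queue cost is affine in `u`, so it has no second difference, whatever the sign of `c`. -/
theorem discreteConvex_bellman {κ : Fin (S + 1) → ℝ} (hκ : DiscreteConvex κ) (c : ℝ)
    {J : Fin (Q - A + 1) × Fin (A + 1) → ℝ} (hJ : ∀ a, DiscreteConvex fun u => J (u, a))
    (a : Fin (A + 1)) : DiscreteConvex fun u => M.bellman κ c J (u, a) := by
  intro i j k hij hjk
  simp only [bellman]
  rw [← Finset.sum_sub_distrib, ← Finset.sum_sub_distrib]
  refine Finset.sum_le_sum fun a' _ => ?_
  rw [← mul_sub, ← mul_sub]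
  refine mul_le_mul_of_nonneg_left ?_ (M.γ_nonneg _ _)
  have h := M.discreteConvex_best hκ (hJ a') (arrive i a') (arrive j a') (arrive k a')
    (by simp only [M.arrive_val]; omega) (by simp only [M.arrive_val]; omega)
  simp only [M.arrive_val, hjk, hij] at h ⊢
  push_cast
  linarith

/-- One step of the controlled process in terms of the packets left over and the arrivals. -/
def Step (x y : Fin (Q - A + 1) × Fin (A + 1)) : Prop :=
  0 < M.γ x.2 y.2 ∧ ∃ s : Fin (S + 1), Feasible A (arrive x.1 y.2) s ∧
    post A (arrive x.1 y.2) s = y.1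

theorem step_of_val {u u' : Fin (Q - A + 1)} {a a' : Fin (A + 1)} (h : 0 < M.γ a a')
    {s : ℕ} (hs : s ≤ S) (hu : (u' : ℕ) + s = u + a') : M.Step (u, a) (u', a') := by
  have hf : Feasible A (arrive u a') (⟨s, by omega⟩ : Fin (S + 1)) := by
    have := M.A_le_Q
    constructor <;> simp only [M.arrive_val] <;> omega
  exact ⟨h, _, hf, Fin.ext (by rw [post_val hf, M.arrive_val]; simp; omega)⟩

/-- Sending exactly the new arrivals, possible as `A ≤ S`, freezes the remainder while the arrivals
move freely. -/
theorem reflTransGen_step_hold (u : Fin (Q - A + 1)) (a b : Fin (A + 1)) :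
    Relation.ReflTransGen M.Step (u, a) (u, b) := by
  have hS := M.A_le_S
  refine (M.reflTransGen_arrivals a b).lift (fun a => (u, a)) fun i j hij => ?_
  exact M.step_of_val hij (s := j) (by omega) rfl

/-- Hold the level until `A` packets can arrive next, then send one fewer than arrive. -/
theorem reflTransGen_step_up {u u' : Fin (Q - A + 1)} (h : (u' : ℕ) = u + 1) (a b : Fin (A + 1)) :
    Relation.ReflTransGen M.Step (u, a) (u', b) := by
  have hS := M.A_le_S; have hA := M.A_pos
  obtain ⟨i, hi⟩ := M.exists_arrival_predecessor (Fin.last A)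
  refine (M.reflTransGen_step_hold u a i).trans
    (.head ?_ (M.reflTransGen_step_hold u' (Fin.last A) b))
  exact M.step_of_val hi (s := A - 1) (by omega) (by simp; omega)

theorem reflTransGen_step_down {u u' : Fin (Q - A + 1)} (h : (u : ℕ) = u' + 1)
    (a b : Fin (A + 1)) : Relation.ReflTransGen M.Step (u, a) (u', b) := by
  have hS := M.A_le_S; have hA := M.A_pos
  obtain ⟨i, hi⟩ := M.exists_arrival_predecessor 0
  refine (M.reflTransGen_step_hold u a i).trans
    (.head ?_ (M.reflTransGen_step_hold u' 0 b))
  exact M.step_of_val hi (s := 1) (by omega) (by simp; omega)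

/-- The controlled process communicates. -/
theorem reflTransGen_step (x y : Fin (Q - A + 1) × Fin (A + 1)) :
    Relation.ReflTransGen M.Step x y := by
  obtain ⟨u, a⟩ := x
  obtain ⟨u', b⟩ := y
  obtain ⟨d, hd⟩ : ∃ d : ℕ, (u' : ℕ) = u + d ∨ (u : ℕ) = u' + d := by
    rcases le_total (u : ℕ) u' with h | h
    · exact ⟨u' - u, by omega⟩
    · exact ⟨u - u', by omega⟩
  induction d generalizing u a with
  | zero =>
    have : u' = u := Fin.ext (by omega)
    subst this
    exact M.reflTransGen_step_hold u' a b
  | succ d ih =>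
    rcases hd with hd | hd
    · exact (M.reflTransGen_step_up (u' := ⟨u + 1, by omega⟩) rfl a b).trans
        (ih _ _ (by simp; omega))
    · exact (M.reflTransGen_step_down (u' := ⟨u - 1, by omega⟩) (by simp; omega) a b).trans
        (ih _ _ (by simp; omega))

/-- `J` is bounded by `B` plus its expectation after one step, for every choice of rates. -/
def Subharmonic (B : ℝ) (J : Fin (Q - A + 1) × Fin (A + 1) → ℝ) : Prop :=
  ∀ (u : Fin (Q - A + 1)) (a : Fin (A + 1)) (σ : Fin (A + 1) → Fin (S + 1)),
    (∀ a', Feasible A (arrive u a') (σ a')) →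
      J (u, a) ≤ B + ∑ a', M.γ a a' * J (post A (arrive u a') (σ a'), a')

/-- If `J` is nearly maximal at `x`, it cannot be very small at a state reachable from `x`: steering
towards that state would make the one-step expectation too small. The constants depend only on the
path and `B`, not on `J`. -/
theorem exists_subharmonic_estimate (B : ℝ) (x y : Fin (Q - A + 1) × Fin (A + 1)) :
    ∃ ε > 0, ∃ K : ℝ, ∀ J, M.Subharmonic B J → ∀ hi : ℝ, (∀ z, J z ≤ hi) →
      ε * (hi - J y) - K ≤ hi - J x := by
  induction M.reflTransGen_step x y using Relation.ReflTransGen.head_induction_on with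
  | refl => exact ⟨1, one_pos, 0, fun J _ hi _ => by linarith⟩
  | @head x z hxz _ ih =>
    obtain ⟨ε, hε, K, h⟩ := ih
    obtain ⟨hγ, s, hs, hz⟩ := hxz
    refine ⟨M.γ x.2 z.2 * ε, mul_pos hγ hε, M.γ x.2 z.2 * K + B, fun J hJ hi hhi => ?_⟩
    have h1 := mul_le_mul_of_nonneg_left (h J hJ hi hhi) hγ.le
    choose σ₀ hσ₀ using fun a' => M.rates_nonempty (arrive x.1 a')
    have h2 := hJ x.1 x.2 (Function.update σ₀ z.2 s) (fun a' => by
      by_cases ha : a' = z.2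
      · subst ha; simpa using hs
      · simpa [ha] using mem_rates.1 (hσ₀ a'))
    have h3 : ∑ a', M.γ x.2 a' *
        (hi - J (post A (arrive x.1 a') (Function.update σ₀ z.2 s a'), a')) ≥
        M.γ x.2 z.2 * (hi - J z) := by
      refine le_trans (le_of_eq ?_) (Finset.single_le_sum (fun a' _ =>
        mul_nonneg (M.γ_nonneg x.2 a') (sub_nonneg.2 (hhi _))) (Finset.mem_univ z.2))
      simp [hz]
    simp only [mul_sub, Finset.sum_sub_distrib, ← Finset.sum_mul, M.γ_sum, one_mul] at h3
    simp only [Prod.mk.eta] at h2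
    nlinarith

/-- Subharmonic functions have uniformly bounded span. -/
theorem exists_span_bound (B : ℝ) :
    ∃ C, ∀ J, M.Subharmonic B J → ∀ x y, J x - J y ≤ C := by
  choose ε hε K h using M.exists_subharmonic_estimate B
  obtain ⟨C, hC⟩ := (Set.finite_range fun p : (Fin (Q - A + 1) × Fin (A + 1)) ×
    (Fin (Q - A + 1) × Fin (A + 1)) => K p.1 p.2 / ε p.1 p.2).bddAbove
  refine ⟨C, fun J hJ x y => ?_⟩
  obtain ⟨z, -, hz⟩ := Finset.exists_max_image Finset.univ J Finset.univ_nonempty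
  -- At a maximizer `z` with `hi = J z`, the right side of the estimate vanishes.
  have h1 := h z y J hJ (J z) fun w => hz w (Finset.mem_univ w)
  have h2 : K z y / ε z y ≤ C := hC ⟨(z, y), rfl⟩
  have h3 : J z - J y ≤ K z y / ε z y := by
    rw [le_div_iff₀ (hε z y)]
    linarith
  have := hz x (Finset.mem_univ x)
  linarith

/-- The discounted operator is a `β`-contraction. Its iterates from 0 are convex in `u`, and this
passes to the limit. -/
theorem exists_discounted_fixedPoint (κ : Fin (S + 1) → ℝ) (c : ℝ) {β : ℝ} (h0 : 0 ≤ β)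
    (h1 : β < 1) : ∃ J : Fin (Q - A + 1) × Fin (A + 1) → ℝ, M.bellman κ c (β • J) = J ∧
      (DiscreteConvex κ → ∀ a, DiscreteConvex fun u => J (u, a)) := by
  have hc : ContractingWith ⟨β, h0⟩
      (fun J : Fin (Q - A + 1) × Fin (A + 1) → ℝ => M.bellman κ c (β • J)) := by
    refine ⟨by exact_mod_cast h1, LipschitzWith.of_dist_le_mul fun J J' => ?_⟩
    refine (M.dist_bellman_le κ c _ _).trans ?_
    rw [dist_smul₀, Real.norm_of_nonneg h0]
    rfl
  refine ⟨hc.fixedPoint, hc.fixedPoint_isFixedPt, fun hκ a i j k hij hjk => ?_⟩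
  have hit : ∀ n a, DiscreteConvex fun u => ((fun J : Fin (Q - A + 1) × Fin (A + 1) → ℝ =>
      M.bellman κ c (β • J))^[n] 0) (u, a) := by
    intro n
    induction n with
    | zero => intro a i j k _ _; simp
    | succ n ih =>
      rw [Function.iterate_succ_apply']
      refine M.discreteConvex_bellman hκ c fun a i j k hij hjk => ?_
      have := mul_le_mul_of_nonneg_left (ih a i j k hij hjk) h0
      simp only [Pi.smul_apply, smul_eq_mul]
      linarith
  have hlim := tendsto_pi_nhds.1 (hc.tendsto_iterate_fixedPoint 0)
  exact le_of_tendsto_of_tendsto' ((hlim (j, a)).sub (hlim (i, a)))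
    ((hlim (k, a)).sub (hlim (j, a))) fun n => hit n a i j k hij hjk

/-- Although `J` may blow up as `β → 1`, `(1 - β) J` stays bounded; its limit will be the average
cost `g`. -/
theorem norm_discounted_le {κ : Fin (S + 1) → ℝ} {c β : ℝ} (h0 : 0 ≤ β)
    {J : Fin (Q - A + 1) × Fin (A + 1) → ℝ} (hJ : M.bellman κ c (β • J) = J) :
    (1 - β) * ‖J‖ ≤ ‖M.bellman κ c 0‖ := by
  have h1 := M.dist_bellman_le κ c (β • J) 0
  rw [hJ, dist_zero_right, norm_smul, Real.norm_of_nonneg h0, dist_eq_norm] at h1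
  have h2 := norm_le_norm_add_norm_sub' J (M.bellman κ c 0)
  linarith

/-- Replacing `β J` by `J` in the discounted equation costs `(1 - β) J`, which is bounded uniformly
in `β`. -/
theorem exists_subharmonic_discounted (κ : Fin (S + 1) → ℝ) (c : ℝ) :
    ∃ B, ∀ β : ℝ, 0 ≤ β → β < 1 → ∀ J, M.bellman κ c (β • J) = J → M.Subharmonic B J := by
  obtain ⟨R, hR⟩ := (Set.finite_range fun p : Fin (S + 1) × Fin (Q + 1) =>
    c * (p.2 : ℕ) + κ p.1).bddAbove
  refine ⟨R + ‖M.bellman κ c 0‖, fun β h0 h1 J hJ u a σ hσ => ?_⟩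
  have hn := M.norm_discounted_le h0 hJ
  calc J (u, a) = M.bellman κ c (β • J) (u, a) := by rw [hJ]
    _ ≤ ∑ a', M.γ a a' * ((R + ‖M.bellman κ c 0‖) + J (post A (arrive u a') (σ a'), a')) := by
      refine Finset.sum_le_sum fun a' _ => mul_le_mul_of_nonneg_left ?_ (M.γ_nonneg _ _)
      have hb := M.best_le κ (β • J) a' (hσ a')
      have hr : c * (arrive u a' : ℕ) + κ (σ a') ≤ R := hR ⟨(σ a', arrive u a'), rfl⟩
      have hnn := norm_le_pi_norm J (post A (arrive u a') (σ a'), a')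
      have habs := neg_abs_le (J (post A (arrive u a') (σ a'), a'))
      rw [Real.norm_eq_abs] at hnn
      have := mul_le_mul_of_nonneg_left hnn (sub_nonneg.2 h1.le)
      have := mul_le_mul_of_nonneg_left habs (sub_nonneg.2 h1.le)
      simp only [Pi.smul_apply, smul_eq_mul] at hb
      simp only
      linarith
    _ = _ := by
      simp only [mul_add, Finset.sum_add_distrib, ← Finset.sum_mul, M.γ_sum, one_mul]

/-- Solution of the average-cost optimality equation by vanishing discount. -/
theorem exists_bellman_eq (κ : Fin (S + 1) → ℝ) (c : ℝ) :
    ∃ (g : ℝ) (J : Fin (Q - A + 1) × Fin (A + 1) → ℝ),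
      (∀ x, M.bellman κ c J x = J x + g) ∧
      (DiscreteConvex κ → ∀ a, DiscreteConvex fun u => J (u, a)) := by
  let β : ℕ → ℝ := fun n => (n : ℝ) / (n + 1)
  have hβ0 : ∀ n, 0 ≤ β n := fun n => by positivity
  have hβ1 : ∀ n, β n < 1 := fun n => by
    have : (0 : ℝ) < n + 1 := by positivity
    rw [div_lt_one this]; linarith
  have hβ : Tendsto β atTop (𝓝 1) := tendsto_natCast_div_add_atTop (1 : ℝ)
  choose J hJ hconv using fun n => M.exists_discounted_fixedPoint κ c (hβ0 n) (hβ1 n)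
  obtain ⟨B, hB⟩ := M.exists_subharmonic_discounted κ c
  obtain ⟨C, hC⟩ := M.exists_span_bound B
  let x₀ : Fin (Q - A + 1) × Fin (A + 1) := (0, 0)
  -- Normalized at `x₀`, the values stay in a compact set by the uniform span bound.
  let p : ℕ → ℝ × (Fin (Q - A + 1) × Fin (A + 1) → ℝ) := fun n =>
    ((1 - β n) * J n x₀, fun x => J n x - J n x₀)
  have hp : ∀ n, p n ∈ Metric.closedBall 0 ‖M.bellman κ c 0‖ ×ˢ Metric.closedBall 0 |C| := by
    intro n
    have hsub := hB _ (hβ0 n) (hβ1 n) _ (hJ n)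
    simp only [p, Set.mem_prod, mem_closedBall_zero_iff]
    constructor
    · rw [norm_mul, Real.norm_of_nonneg (sub_nonneg.2 (hβ1 n).le)]
      exact (mul_le_mul_of_nonneg_left (norm_le_pi_norm _ _) (sub_nonneg.2 (hβ1 n).le)).trans
        (M.norm_discounted_le (hβ0 n) (hJ n))
    · rw [pi_norm_le_iff_of_nonneg (abs_nonneg C)]
      intro x
      rw [Real.norm_eq_abs, abs_le]
      have := hC _ hsub x x₀
      have := hC _ hsub x₀ x
      have := le_abs_self C
      constructor <;> linarith
  obtain ⟨⟨g, j⟩, -, ψ, hψ, hlim⟩ := ((isCompact_closedBall (0 : ℝ) _).prod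
    (isCompact_closedBall (0 : Fin (Q - A + 1) × Fin (A + 1) → ℝ) _)).tendsto_subseq hp
  rw [nhds_prod_eq] at hlim
  have hg : Tendsto (fun n => (1 - β (ψ n)) * J (ψ n) x₀) atTop (𝓝 g) := hlim.fst
  have hj : Tendsto (fun n => (fun x => J (ψ n) x - J (ψ n) x₀)) atTop (𝓝 j) := hlim.snd
  have hjx := tendsto_pi_nhds.1 hj
  refine ⟨g, j, fun x => ?_, fun hκ a i k l hik hkl => ?_⟩
  · have h1 : Tendsto (fun n => M.bellman κ c (β (ψ n) • fun x => J (ψ n) x - J (ψ n) x₀) x)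
        atTop (𝓝 (M.bellman κ c ((1 : ℝ) • j) x)) :=
      tendsto_pi_nhds.1 (((M.continuous_bellman κ c).tendsto _).comp
        ((hβ.comp hψ.tendsto_atTop).smul hj)) x
    rw [one_smul] at h1
    refine tendsto_nhds_unique h1 (((hjx x).add hg).congr fun n => ?_)
    -- Pulling the constant out of `bellman` leaves `J - β J x₀ = (J - J x₀) + (1 - β) J x₀`.
    have h2 : (β (ψ n) • fun x => J (ψ n) x - J (ψ n) x₀) =
        fun x => (β (ψ n) • J (ψ n)) x + -(β (ψ n) * J (ψ n) x₀) := by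
      funext x; simp; ring
    rw [h2, bellman_add_const, hJ]
    ring
  · refine le_of_tendsto_of_tendsto' ((hjx (k, a)).sub (hjx (i, a)))
      ((hjx (l, a)).sub (hjx (k, a))) fun n => ?_
    have := hconv (ψ n) hκ a i k l hik hkl
    linarith

/-! ### Stationary laws of policies -/

theorem trans_nonneg (F : Policy Q A S) (x y : State Q A) : 0 ≤ M.trans F x y :=
  Finset.sum_nonneg fun s _ => mul_nonneg (mul_nonneg (M.γ_nonneg _ _) (F.nonneg _ _ s))
    (by split_ifs <;> simp)

theorem sum_trans_mul (F : Policy Q A S) (x : State Q A) (h : State Q A → ℝ) :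
    ∑ y, M.trans F x y * h y =
      ∑ s, F.f x.1 x.2 s * ∑ a', M.γ x.2 a' * h (nextQueue x.1 s a', a') := by
  simp only [trans, Finset.sum_mul, Finset.mul_sum, Fintype.sum_prod_type]
  calc _ = ∑ a', ∑ s, ∑ q', M.γ x.2 a' * F.f x.1 x.2 s *
        (if q' = nextQueue x.1 s a' then 1 else 0) * h (q', a') := by
        rw [Finset.sum_comm]
        exact Finset.sum_congr rfl fun a' _ => Finset.sum_comm
    _ = _ := by
        rw [Finset.sum_comm]
        refine Finset.sum_congr rfl fun s _ => Finset.sum_congr rfl fun a' _ => ?_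
        simp
        ring

theorem sum_trans (F : Policy Q A S) (x : State Q A) : ∑ y, M.trans F x y = 1 := by
  have := M.sum_trans_mul F x fun _ => 1
  simpa [M.γ_sum, F.sum_one] using this

theorem sum_trans_pow (F : Policy Q A S) (x : State Q A) (n : ℕ) :
    ∑ y, (M.trans F ^ n) x y = 1 := by
  induction n generalizing x with
  | zero => simp [Matrix.one_apply]
  | succ n ih =>
    simp only [pow_succ', Matrix.mul_apply]
    rw [Finset.sum_comm]
    simp only [← Finset.mul_sum, ih, mul_one, M.sum_trans]

theorem trans_pow_nonneg (F : Policy Q A S) (n : ℕ) (x y : State Q A) :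
    0 ≤ (M.trans F ^ n) x y :=
  Matrix.pow_apply_nonneg (M.trans_nonneg F) n x y

/-- Stationary laws of the state process under a policy. -/
def IsStationary (F : Policy Q A S) (o : State Q A → ℝ) : Prop :=
  (∀ y, 0 ≤ o y) ∧ ∑ y, o y = 1 ∧ ∀ z, ∑ y, o y * M.trans F y z = o z

/-- Mean power and mean delay of a policy under a law on the states. -/
noncomputable def averages (F : Policy Q A S) (o : State Q A → ℝ) : ℝ × ℝ :=
  (∑ y, o y * ∑ s, M.power s * F.f y.1 y.2 s, ∑ y, o y * ((1 / M.α) * ((y.1 : ℕ) : ℝ)))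

theorem IsStationary.averages_mem_region {F : Policy Q A S} {o : State Q A → ℝ}
    (h : M.IsStationary F o) : M.averages F o ∈ M.region := by
  obtain ⟨h0, h1, hst⟩ := h
  refine ⟨fun q a s => o (q, a) * F.f q a s, ⟨fun q a s => mul_nonneg (h0 _) (F.nonneg _ _ _),
    fun q a s hs => by simp [F.feasible q a s hs], ?_, fun q' a' => ?_⟩, ?_, ?_⟩
  · simp only [← Finset.mul_sum, F.sum_one, mul_one]
    rw [← h1, Fintype.sum_prod_type]
  · simp only [← Finset.mul_sum, F.sum_one, mul_one]
    rw [← hst (q', a'), Fintype.sum_prod_type]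
    refine Finset.sum_congr rfl fun q _ => Finset.sum_congr rfl fun a _ => ?_
    simp only [trans, Finset.mul_sum]
    exact Finset.sum_congr rfl fun s _ => by ring
  · simp only [averages, Finset.mul_sum, Fintype.sum_prod_type]
    refine Finset.sum_congr rfl fun q _ => Finset.sum_congr rfl fun a _ =>
      Finset.sum_congr rfl fun s _ => by ring
  · simp only [averages, Finset.mul_sum, Fintype.sum_prod_type]
    refine Finset.sum_congr rfl fun q _ => Finset.sum_congr rfl fun a _ => ?_
    simp only [← mul_assoc, ← Finset.mul_sum, F.sum_one]
    ring

/-- Expected fraction of the slots `1, …, N` spent in each state. -/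
noncomputable def visits (F : Policy Q A S) (x : State Q A) (N : ℕ) : State Q A → ℝ :=
  fun y => (1 / (N : ℝ)) * ∑ n ∈ Finset.Icc 1 N, (M.trans F ^ n) x y

theorem averages_visits (F : Policy Q A S) (x : State Q A) (N : ℕ) :
    M.averages F (M.visits F x N) = (M.meanPower F x N, M.meanDelay F x N) := by
  simp only [averages, visits, meanPower, meanDelay, mul_assoc, ← Finset.mul_sum]
  congr 2 <;>
  · simp only [Finset.sum_mul]
    rw [Finset.sum_comm]

theorem visits_nonneg (F : Policy Q A S) (x : State Q A) (N : ℕ) (y : State Q A) :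
    0 ≤ M.visits F x N y :=
  mul_nonneg (by positivity) (Finset.sum_nonneg fun n _ => M.trans_pow_nonneg F n x y)

theorem sum_visits (F : Policy Q A S) (x : State Q A) {N : ℕ} (hN : N ≠ 0) :
    ∑ y, M.visits F x N y = 1 := by
  simp only [visits, ← Finset.mul_sum]
  rw [Finset.sum_comm]
  simp only [M.sum_trans_pow]
  have : (N : ℝ) ≠ 0 := by exact_mod_cast hN
  simp [this]

/-- Shifting time by one slot telescopes, so visit frequencies are invariant up to a boundary term
of order `1 / N`. -/
theorem sum_visits_mul_trans (F : Policy Q A S) (x : State Q A) (N : ℕ) (z : State Q A) :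
    ∑ y, M.visits F x N y * M.trans F y z = M.visits F x N z +
      (1 / (N : ℝ)) * ((M.trans F ^ (N + 1)) x z - (M.trans F ^ 1) x z) := by
  have key : ∀ N : ℕ, ∑ n ∈ Finset.Icc 1 N, (M.trans F ^ (n + 1)) x z =
      (∑ n ∈ Finset.Icc 1 N, (M.trans F ^ n) x z) +
        ((M.trans F ^ (N + 1)) x z - (M.trans F ^ 1) x z) := by
    intro N
    induction N with
    | zero => simp
    | succ N ih =>
      rw [Finset.sum_Icc_succ_top (by omega), Finset.sum_Icc_succ_top (by omega), ih]
      ring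
  simp only [visits]
  rw [← mul_add, ← key]
  simp only [mul_assoc, ← Finset.mul_sum, Finset.sum_mul]
  rw [Finset.sum_comm]
  simp only [pow_succ (M.trans F), Matrix.mul_apply]

/-- Krylov–Bogoliubov: limit points of visit frequencies are stationary. Starting from an arbitrary
sequence of horizons allows convergence of the full sequence to be deduced later. -/
theorem exists_subseq_stationary (F : Policy Q A S) (x : State Q A) {ns : ℕ → ℕ}
    (hns : Tendsto ns atTop atTop) :
    ∃ (ms : ℕ → ℕ) (o : State Q A → ℝ), StrictMono ms ∧ M.IsStationary F o ∧
      Tendsto (fun n => (M.meanPower F x (ns (ms n)), M.meanDelay F x (ns (ms n)))) atTop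
        (𝓝 (M.averages F o)) := by
  have hle : ∀ n y, M.visits F x (ns n) y ≤ 1 := by
    intro n y
    rcases eq_or_ne (ns n) 0 with h | h
    · simp [visits, h]
    · rw [← M.sum_visits F x h]
      exact Finset.single_le_sum (fun y _ => M.visits_nonneg F x _ y) (Finset.mem_univ y)
  obtain ⟨o, -, ms, hms, hlim⟩ := (isCompact_univ_pi fun _ : State Q A =>
    isCompact_Icc (a := (0 : ℝ)) (b := 1)).tendsto_subseq (x := fun n => M.visits F x (ns n))
    fun n y _ => ⟨M.visits_nonneg F x _ y, hle n y⟩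
  have hy := tendsto_pi_nhds.1 hlim
  have hN : Tendsto (fun n => ns (ms n)) atTop atTop := hns.comp hms.tendsto_atTop
  refine ⟨ms, o, hms, ⟨fun y => ge_of_tendsto' (hy y) fun n => M.visits_nonneg F x _ y, ?_,
    fun z => ?_⟩, ?_⟩
  · refine tendsto_nhds_unique (tendsto_finsetSum Finset.univ fun y _ => hy y) ?_
    refine tendsto_const_nhds.congr' ?_
    filter_upwards [hN.eventually_ne_atTop 0] with n hn
    exact (M.sum_visits F x hn).symm
  · have h1 := tendsto_finsetSum Finset.univ fun y _ => (hy y).mul_const (M.trans F y z)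
    have hle1 : ∀ n, (M.trans F ^ n) x z ≤ 1 := fun n => by
      rw [← M.sum_trans_pow F x n]
      exact Finset.single_le_sum (fun y _ => M.trans_pow_nonneg F n x y) (Finset.mem_univ z)
    have h2 : Tendsto (fun n => (1 / ((ns (ms n) : ℕ) : ℝ)) *
        ((M.trans F ^ (ns (ms n) + 1)) x z - (M.trans F ^ 1) x z)) atTop (𝓝 0) := by
      refine ((tendsto_one_div_atTop_nhds_zero_nat (𝕜 := ℝ)).comp hN).zero_mul_isBoundedUnder_le ?_
      refine isBoundedUnder_of ⟨1, fun n => ?_⟩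
      simp only [Function.comp, Real.norm_eq_abs]
      rw [abs_le]
      have := hle1 (ns (ms n) + 1); have := hle1 1
      have := M.trans_pow_nonneg F (ns (ms n) + 1) x z
      have := M.trans_pow_nonneg F 1 x z
      constructor <;> linarith
    refine tendsto_nhds_unique h1 ?_
    have h3 := (hy z).add h2
    rw [add_zero] at h3
    exact h3.congr fun n => (M.sum_visits_mul_trans F x _ z).symm
  · have hc : Continuous (M.averages F) := by
      unfold averages
      fun_prop
    exact ((hc.tendsto o).comp hlim).congr fun n => M.averages_visits F x _

theorem mem_region_of_hasAverages {F : Policy Q A S} {x : State Q A} {p : ℝ × ℝ}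
    (h : M.HasAverages F x p) : p ∈ M.region := by
  obtain ⟨ms, o, hms, ho, hlim⟩ := M.exists_subseq_stationary F x tendsto_id
  have h' : Tendsto (fun n => (M.meanPower F x n, M.meanDelay F x n)) atTop (𝓝 p) :=
    h.1.prodMk_nhds h.2
  rw [tendsto_nhds_unique (h'.comp hms.tendsto_atTop) hlim]
  exact ho.averages_mem_region

/-- If all stationary laws have the averages `v`, so has the policy from every initial state. -/
theorem hasAverages_of_forall_stationary {F : Policy Q A S} {v : ℝ × ℝ}
    (h : ∀ o, M.IsStationary F o → M.averages F o = v) (x : State Q A) :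
    M.HasAverages F x v := by
  have : Tendsto (fun n => (M.meanPower F x n, M.meanDelay F x n)) atTop (𝓝 v) := by
    refine tendsto_of_subseq_tendsto fun ns hns => ?_
    obtain ⟨ms, o, -, ho, hlim⟩ := M.exists_subseq_stationary F x hns
    exact ⟨ms, h o ho ▸ hlim⟩
  rw [nhds_prod_eq] at this
  exact ⟨this.fst, this.snd⟩

/-! ### Optimal deterministic policies -/

/-- The deterministic policy that uses rate `σ (q, a)` in state `(q, a)`. -/
def ratePolicy (σ : State Q A → Fin (S + 1)) (hσ : ∀ x, Feasible A x.1 (σ x)) :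
    Policy Q A S where
  f q a s := if s = σ (q, a) then 1 else 0
  nonneg q a s := by split_ifs <;> simp
  sum_one q a := by simp
  feasible q a s h := if_neg fun e => h (by rw [e]; exact hσ (q, a))

theorem sum_trans_ratePolicy_mul {σ : State Q A → Fin (S + 1)} (hσ : ∀ x, Feasible A x.1 (σ x))
    (x : State Q A) (h : State Q A → ℝ) :
    ∑ y, M.trans (ratePolicy σ hσ) x y * h y =
      ∑ a', M.γ x.2 a' * h (nextQueue x.1 (σ x) a', a') := by
  rw [sum_trans_mul]
  simp [ratePolicy]

/-- Weak duality: weighted by frequencies, the optimality inequality loses its `h` terms through the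
balance equations. -/
theorem le_of_mem_region {m c g : ℝ} {h : State Q A → ℝ}
    (H : ∀ q a s, Feasible A q s → h (q, a) + g ≤ m * M.power s + c / M.α * (q : ℕ) +
      ∑ a', M.γ a a' * h (nextQueue q s a', a')) {p : ℝ × ℝ} (hp : p ∈ M.region) :
    g ≤ m * p.1 + c * p.2 := by
  obtain ⟨x, ⟨h0, hf, h1, hb⟩, hp1, hp2⟩ := hp
  have key : ∑ q, ∑ a, ∑ s, x q a s * (h (q, a) + g) ≤ ∑ q, ∑ a, ∑ s, x q a s *
      (m * M.power s + c / M.α * (q : ℕ) + ∑ a', M.γ a a' * h (nextQueue q s a', a')) := by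
    refine Finset.sum_le_sum fun q _ => Finset.sum_le_sum fun a _ => Finset.sum_le_sum fun s _ => ?_
    by_cases hs : Feasible A q s
    · exact mul_le_mul_of_nonneg_left (H q a s hs) (h0 q a s)
    · simp [hf q a s hs]
  have hbal : ∑ q, ∑ a, ∑ s, x q a s * ∑ a', M.γ a a' * h (nextQueue q s a', a') =
      ∑ q, ∑ a, ∑ s, x q a s * h (q, a) := by
    have e : ∀ q' a', ∑ s, x q' a' s * h (q', a') =
        ∑ q, ∑ a, ∑ s, M.γ a a' * x q a s * (if q' = nextQueue q s a' then 1 else 0) *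
          h (q', a') := by
      intro q' a'
      rw [← Finset.sum_mul, ← hb q' a']
      simp only [Finset.sum_mul]
    simp only [e]
    symm
    calc _ = ∑ a', ∑ q, ∑ a, ∑ s, ∑ q', M.γ a a' * x q a s *
          (if q' = nextQueue q s a' then 1 else 0) * h (q', a') := by
          rw [Finset.sum_comm]
          refine Finset.sum_congr rfl fun a' _ => ?_
          rw [Finset.sum_comm]
          refine Finset.sum_congr rfl fun q _ => ?_
          rw [Finset.sum_comm]
          exact Finset.sum_congr rfl fun a _ => Finset.sum_comm
      _ = ∑ a', ∑ q, ∑ a, ∑ s, x q a s * (M.γ a a' * h (nextQueue q s a', a')) := by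
          refine Finset.sum_congr rfl fun a' _ => Finset.sum_congr rfl fun q _ =>
            Finset.sum_congr rfl fun a _ => Finset.sum_congr rfl fun s _ => ?_
          simp
          ring
      _ = _ := by
          simp only [Finset.mul_sum]
          rw [Finset.sum_comm]
          refine Finset.sum_congr rfl fun q _ => ?_
          rw [Finset.sum_comm]
          exact Finset.sum_congr rfl fun a _ => Finset.sum_comm
  simp only [mul_add, Finset.sum_add_distrib] at key
  rw [hbal] at key
  have e1 : ∑ q, ∑ a, ∑ s, x q a s * g = g := by
    simp only [← Finset.sum_mul, h1, one_mul]
  have e2 : ∑ q, ∑ a, ∑ s, x q a s * (m * M.power s) = m * p.1 := by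
    rw [hp1]
    simp only [Finset.mul_sum]
    exact Finset.sum_congr rfl fun q _ => Finset.sum_congr rfl fun a _ =>
      Finset.sum_congr rfl fun s _ => by ring
  have e3 : ∑ q, ∑ a, ∑ s, x q a s * (c / M.α * ((q : ℕ) : ℝ)) = c * p.2 := by
    rw [hp2]
    simp only [Finset.mul_sum]
    exact Finset.sum_congr rfl fun q _ => Finset.sum_congr rfl fun a _ =>
      Finset.sum_congr rfl fun s _ => by ring
  rw [e1, e2, e3] at key
  linarith

/-- The same cancellation, now with equality in every state. -/
theorem eq_of_isStationary {m c g : ℝ} {h : State Q A → ℝ} {σ : State Q A → Fin (S + 1)}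
    {hσ : ∀ x, Feasible A x.1 (σ x)}
    (H : ∀ x, h x + g = m * M.power (σ x) + c / M.α * (x.1 : ℕ) +
      ∑ a', M.γ x.2 a' * h (nextQueue x.1 (σ x) a', a')) {o : State Q A → ℝ}
    (ho : M.IsStationary (ratePolicy σ hσ) o) :
    m * (M.averages (ratePolicy σ hσ) o).1 + c * (M.averages (ratePolicy σ hσ) o).2 = g := by
  obtain ⟨-, h1, hst⟩ := ho
  have key : ∑ x, o x * (h x + g) = ∑ x, o x * (m * M.power (σ x) + c / M.α * (x.1 : ℕ) +
      ∑ y, M.trans (ratePolicy σ hσ) x y * h y) :=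
    Finset.sum_congr rfl fun x _ => by rw [H x, M.sum_trans_ratePolicy_mul hσ]
  have e : ∑ x, o x * ∑ y, M.trans (ratePolicy σ hσ) x y * h y = ∑ y, o y * h y := by
    simp only [Finset.mul_sum]
    rw [Finset.sum_comm]
    refine Finset.sum_congr rfl fun y _ => ?_
    rw [← hst y, Finset.sum_mul]
    exact Finset.sum_congr rfl fun x _ => by ring
  simp only [mul_add, Finset.sum_add_distrib, ← Finset.sum_mul, h1, one_mul, e] at key
  have e2 : m * (M.averages (ratePolicy σ hσ) o).1 = ∑ x, o x * (m * M.power (σ x)) := by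
    simp only [averages, ratePolicy, mul_ite, mul_one, mul_zero, Finset.sum_ite_eq',
      Finset.mem_univ, if_true, Finset.mul_sum]
    exact Finset.sum_congr rfl fun x _ => by ring
  have e3 : c * (M.averages (ratePolicy σ hσ) o).2 =
      ∑ x : State Q A, o x * (c / M.α * ((x.1 : ℕ) : ℝ)) := by
    simp only [averages, Finset.mul_sum]
    exact Finset.sum_congr rfl fun x _ => by ring
  rw [e2, e3]
  linarith

/-- Rates chosen as large as possible among the minimizers: both the rate and the number of
packets left over are nondecreasing in the queue length. -/
theorem exists_monotone_minimizer {κ : Fin (S + 1) → ℝ}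
    {J : Fin (Q - A + 1) × Fin (A + 1) → ℝ} :
    ∃ σ : State Q A → Fin (S + 1), (∀ x, Feasible A x.1 (σ x)) ∧
      (∀ x, M.best κ J x.1 x.2 = κ (σ x) + J (post A x.1 (σ x), x.2)) ∧
      (DiscreteConvex κ → (∀ a, DiscreteConvex fun u => J (u, a)) →
        ∀ (q q' : Fin (Q + 1)) (a : Fin (A + 1)), (q' : ℕ) = q + 1 →
          (σ (q, a) : ℕ) ≤ σ (q', a) ∧ (σ (q', a) : ℕ) ≤ σ (q, a) + 1) := by
  have hex : ∀ x : State Q A, ∃ s, (Feasible A x.1 s ∧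
      M.best κ J x.1 x.2 = κ s + J (post A x.1 s, x.2)) ∧
      ∀ t, Feasible A x.1 t → M.best κ J x.1 x.2 = κ t + J (post A x.1 t, x.2) → t ≤ s := by
    intro x
    classical
    obtain ⟨s₀, hs₀⟩ := M.exists_best_eq κ J x.1 x.2
    obtain ⟨s, hs, hmax⟩ := Finset.exists_max_image (Finset.univ.filter fun s =>
      Feasible A x.1 s ∧ M.best κ J x.1 x.2 = κ s + J (post A x.1 s, x.2)) id
      ⟨s₀, by simpa using hs₀⟩
    exact ⟨s, by simpa using hs, fun t h1 h2 => hmax t (by simpa using ⟨h1, h2⟩)⟩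
  choose σ hσ hmax using hex
  refine ⟨σ, fun x => (hσ x).1, fun x => (hσ x).2, fun hκ hJ q q' a hq => ?_⟩
  obtain ⟨hs, e⟩ := hσ (q, a)
  obtain ⟨hs', e'⟩ := hσ (q', a)
  have hm := hmax (q, a)
  have hm' := hmax (q', a)
  generalize σ (q, a) = s at *
  generalize σ (q', a) = s' at *
  simp only at hs e hs' e' hm hm'
  have f := hs.1; have f' := hs.2
  have k := hs'.1; have k' := hs'.2
  have hQ := M.A_le_Q
  constructor
  -- If the rate dropped, exchanging the two rates would not raise the total cost, by convexity of
  -- `J`. The larger rate would then be optimal at `q'` too, against maximality.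
  · by_contra! hlt
    have t : Feasible A q s' := ⟨by omega, by omega⟩
    have t' : Feasible A q' s := ⟨by omega, by omega⟩
    have b := M.best_le κ J a t
    have b' := M.best_le κ J a t'
    have := (hJ a).exchange (i := post A q s) (i' := post A q' s) (j' := post A q s')
      (j := post A q' s') (by rw [post_val t', post_val hs]; omega)
      (by rw [post_val t, post_val hs']; omega) (by rw [post_val t, post_val hs]; omega)
    have := Fin.le_def.1 (hm' s t' (by linarith))
    omega
  -- If the rate jumped by two or more, exchanging the remainders moves the rates together. By
  -- convexity of `κ`, `s' - 1 > s` would be optimal at `q`.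
  · by_contra! hlt
    obtain ⟨r, hr⟩ : ∃ r : Fin (S + 1), (r : ℕ) = s + 1 := ⟨⟨s + 1, by omega⟩, rfl⟩
    obtain ⟨r', hr'⟩ : ∃ r : Fin (S + 1), (s' : ℕ) = r + 1 :=
      ⟨⟨s' - 1, by omega⟩, by simp; omega⟩
    have t : Feasible A q r' := ⟨by omega, by omega⟩
    have t' : Feasible A q' r := ⟨by omega, by omega⟩
    have b := M.best_le κ J a t
    have b' := M.best_le κ J a t'
    have p : post A q r' = post A q' s' := Fin.ext (by rw [post_val t, post_val hs']; omega)
    have p' : post A q' r = post A q s := Fin.ext (by rw [post_val t', post_val hs]; omega)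
    rw [p] at b
    rw [p'] at b'
    have := hκ.exchange hr hr' (by omega)
    have := Fin.le_def.1 (hm r' t (by rw [p]; linarith))
    omega

/-- For every linear functional of power and delay there is a deterministic policy all of whose
stationary laws minimize it over the region; when the weight of the power is nonnegative, the rates
and the numbers of packets left over may be taken nondecreasing in the queue length. -/
theorem exists_optimal_rates (m c : ℝ) :
    ∃ (g : ℝ) (σ : State Q A → Fin (S + 1)) (hσ : ∀ x, Feasible A x.1 (σ x)),
      (∀ p ∈ M.region, g ≤ m * p.1 + c * p.2) ∧
      (∀ o, M.IsStationary (ratePolicy σ hσ) o →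
        m * (M.averages (ratePolicy σ hσ) o).1 + c * (M.averages (ratePolicy σ hσ) o).2 = g) ∧
      (0 ≤ m → ∀ (q q' : Fin (Q + 1)) (a : Fin (A + 1)), (q' : ℕ) = q + 1 →
        (σ (q, a) : ℕ) ≤ σ (q', a) ∧ (σ (q', a) : ℕ) ≤ σ (q, a) + 1) := by
  obtain ⟨g, J, hJ, hconv⟩ := M.exists_bellman_eq (fun s => m * M.power s) (c / M.α)
  obtain ⟨σ, hσ, hbest, hmono⟩ :=
    M.exists_monotone_minimizer (κ := fun s => m * M.power s) (J := J)
  -- Cost-to-go before transmission; its expectation after a feasible step is `bellman J`, hence `J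
  -- + g`, at the remainder.
  let h : State Q A → ℝ := fun x =>
    c / M.α * (x.1 : ℕ) + M.best (fun s => m * M.power s) J x.1 x.2
  have hnext : ∀ (q : Fin (Q + 1)) (a : Fin (A + 1)) (s : Fin (S + 1)), Feasible A q s →
      ∑ a', M.γ a a' * h (nextQueue q s a', a') = J (post A q s, a) + g := by
    intro q a s hs
    rw [← hJ]
    simp only [bellman, h, nextQueue_eq_arrive hs]
  refine ⟨g, σ, hσ, fun p hp => M.le_of_mem_region (h := h) (fun q a s hs => ?_) hp,
    fun o ho => M.eq_of_isStationary (h := h) (fun x => ?_) ho, fun hm => ?_⟩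
  · rw [hnext q a s hs]
    have := M.best_le (fun s => m * M.power s) J a hs
    simp only [h]
    linarith
  · rw [hnext x.1 x.2 _ (hσ x)]
    simp only [h, hbest x]
    ring
  · have hκ : DiscreteConvex fun s => m * M.power s := fun i j k hij hjk => by
      have := mul_le_mul_of_nonneg_left (M.power_convex i j k hij hjk) hm
      simp only
      linarith
    exact hmono hκ (hconv hκ)

/-! ### The region is a polygon -/

theorem exists_isStationary (F : Policy Q A S) : ∃ o, M.IsStationary F o := by
  obtain ⟨-, o, -, ho, -⟩ := M.exists_subseq_stationary F (0, 0) tendsto_id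
  exact ⟨o, ho⟩

/-- There are finitely many deterministic policies, and one stationary law for each suffices: all
laws of an optimal policy give the same minimum. -/
theorem exists_finite_minimizers :
    ∃ E : Set (ℝ × ℝ), E.Finite ∧ E ⊆ M.region ∧
      ∀ m c : ℝ, ∃ p ∈ E, ∀ p' ∈ M.region, m * p.1 + c * p.2 ≤ m * p'.1 + c * p'.2 := by
  choose o ho using M.exists_isStationary
  refine ⟨Set.range fun σ : {σ : State Q A → Fin (S + 1) // ∀ x, Feasible A x.1 (σ x)} =>
    M.averages (ratePolicy σ.1 σ.2) (o (ratePolicy σ.1 σ.2)), Set.finite_range _, ?_, ?_⟩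
  · rintro _ ⟨σ, rfl⟩
    exact (ho _).averages_mem_region
  · intro m c
    obtain ⟨g, σ, hσ, h1, h2, -⟩ := M.exists_optimal_rates m c
    exact ⟨_, ⟨⟨σ, hσ⟩, rfl⟩, fun p hp => (h2 _ (ho _)).trans_le (h1 p hp)⟩

theorem convex_region : Convex ℝ M.region := by
  rintro p ⟨x, ⟨hx0, hxf, hx1, hxb⟩, hp1, hp2⟩ p' ⟨y, ⟨hy0, hyf, hy1, hyb⟩, hp1', hp2'⟩ t t' ht ht' h
  have lin : ∀ w : Fin (Q + 1) → Fin (A + 1) → Fin (S + 1) → ℝ,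
      ∑ q, ∑ a, ∑ s, w q a s * (t * x q a s + t' * y q a s) =
        t * ∑ q, ∑ a, ∑ s, w q a s * x q a s + t' * ∑ q, ∑ a, ∑ s, w q a s * y q a s := by
    intro w
    simp only [Finset.mul_sum, ← Finset.sum_add_distrib]
    exact Finset.sum_congr rfl fun q _ => Finset.sum_congr rfl fun a _ =>
      Finset.sum_congr rfl fun s _ => by ring
  refine ⟨fun q a s => t * x q a s + t' * y q a s, ⟨fun q a s => ?_, fun q a s hs => ?_, ?_,
    fun q' a' => ?_⟩, ?_, ?_⟩
  · exact add_nonneg (mul_nonneg ht (hx0 _ _ _)) (mul_nonneg ht' (hy0 _ _ _))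
  · simp [hxf q a s hs, hyf q a s hs]
  · have := lin fun _ _ _ => 1
    simpa [hx1, hy1, h] using this
  · have := lin fun q a s => M.γ a a' * (if q' = nextQueue q s a' then 1 else 0)
    have e := hxb q' a'
    have e' := hyb q' a'
    simp only [mul_right_comm _ (ite _ _ _)] at this
    rw [this, e, e', Finset.sum_add_distrib, Finset.mul_sum, Finset.mul_sum]
  · rw [lin, ← hp1, ← hp1']
    rfl
  · have := lin fun q _ _ => ((q : ℕ) : ℝ)
    rw [this, mul_add, mul_left_comm, mul_left_comm _ t', ← hp2, ← hp2']
    rfl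

theorem linear_apply_prod (f : StrongDual ℝ (ℝ × ℝ)) (p : ℝ × ℝ) :
    f p = f (1, 0) * p.1 + f (0, 1) * p.2 := by
  have : p = p.1 • (1, 0) + p.2 • (0, 1) := by ext <;> simp
  conv_lhs => rw [this]
  rw [map_add, map_smul, map_smul, smul_eq_mul, smul_eq_mul, mul_comm, mul_comm p.2]

/-- A region point outside the hull would be separated from it by a functional whose minimum is
nevertheless attained in `E`. -/
theorem exists_finite_region_eq_convexHull :
    ∃ E : Set (ℝ × ℝ), E.Finite ∧ M.region = convexHull ℝ E := by
  obtain ⟨E, hE, hsub, hmin⟩ := M.exists_finite_minimizers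
  refine ⟨E, hE, subset_antisymm (fun p hp => ?_) (convexHull_min hsub M.convex_region)⟩
  by_contra hnot
  obtain ⟨f, u, h1, h2⟩ := geometric_hahn_banach_point_closed (convex_convexHull ℝ E)
    (hE.isClosed_convexHull ℝ) hnot
  obtain ⟨e, he, hle⟩ := hmin (f (1, 0)) (f (0, 1))
  have h3 := hle p hp
  rw [← linear_apply_prod, ← linear_apply_prod] at h3
  have := h2 e (subset_convexHull ℝ E he)
  linarith

/-! ### The point of least delay -/

/-- The arrivals are distributed according to `φ` under all state-action frequencies. -/
theorem sum_frequencies_eq_φ {x : Fin (Q + 1) → Fin (A + 1) → Fin (S + 1) → ℝ}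
    (hx : x ∈ M.frequencies) (a : Fin (A + 1)) : ∑ q, ∑ s, x q a s = M.φ a := by
  obtain ⟨-, -, h1, hb⟩ := hx
  refine congrFun (M.stationary_unique (ψ := fun a => ∑ q, ∑ s, x q a s) ?_ fun a' => ?_) a
  · rw [← h1, Finset.sum_comm]
  · rw [← Finset.sum_congr rfl fun q' _ => hb q' a']
    calc _ = ∑ q, ∑ a, ∑ s, M.γ a a' * x q a s := by
          simp only [Finset.sum_mul]
          rw [Finset.sum_comm]
          exact Finset.sum_congr rfl fun q _ => Finset.sum_congr rfl fun a _ =>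
            Finset.sum_congr rfl fun s _ => mul_comm _ _
      _ = ∑ q, ∑ a, ∑ s, ∑ q', M.γ a a' * x q a s *
            (if q' = nextQueue q s a' then 1 else 0) := by simp
      _ = _ := by
          symm
          rw [Finset.sum_comm]
          refine Finset.sum_congr rfl fun q _ => ?_
          rw [Finset.sum_comm]
          exact Finset.sum_congr rfl fun a _ => Finset.sum_comm

theorem sum_frequencies_mul {x : Fin (Q + 1) → Fin (A + 1) → Fin (S + 1) → ℝ}
    (hx : x ∈ M.frequencies) (w : Fin (A + 1) → ℝ) :
    ∑ q, ∑ a, ∑ s, w a * x q a s = ∑ a, w a * M.φ a := by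
  rw [Finset.sum_comm]
  exact Finset.sum_congr rfl fun a _ => by
    simp only [← Finset.mul_sum, M.sum_frequencies_eq_φ hx]

/-- The queue contains at least the packets that just arrived. -/
theorem frequencies_eq_zero_of_lt {x : Fin (Q + 1) → Fin (A + 1) → Fin (S + 1) → ℝ}
    (hx : x ∈ M.frequencies) {q : Fin (Q + 1)} {a : Fin (A + 1)} (h : (q : ℕ) < a)
    (s : Fin (S + 1)) : x q a s = 0 := by
  obtain ⟨h0, hf, -, hb⟩ := hx
  have hz := hb q a
  rw [Finset.sum_eq_zero fun q' _ => Finset.sum_eq_zero fun a' _ => Finset.sum_eq_zero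
    fun s' _ => ?_] at hz
  · exact (Finset.sum_eq_zero_iff_of_nonneg fun s _ => h0 q a s).1 hz.symm s (Finset.mem_univ s)
  · by_cases hs : Feasible A q' s'
    · rw [if_neg, mul_zero]
      intro e
      have := nextQueue_val hs a
      rw [← e] at this
      omega
    · simp [hf q' a' s' hs]

/-- The arrivals have mean `α` under all frequencies, so delay beyond 1 measures the packets already
queued before the current arrivals. -/
theorem delay_sub_one {x : Fin (Q + 1) → Fin (A + 1) → Fin (S + 1) → ℝ}
    (hx : x ∈ M.frequencies) :
    (1 / M.α) * ∑ q : Fin (Q + 1), ∑ a, ∑ s, ((q : ℕ) : ℝ) * x q a s - 1 =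
      (1 / M.α) * ∑ q : Fin (Q + 1), ∑ a : Fin (A + 1), ∑ s,
        (((q : ℕ) : ℝ) - ((a : ℕ) : ℝ)) * x q a s := by
  have h := M.sum_frequencies_mul hx fun a => ((a : ℕ) : ℝ)
  simp only [sub_mul, Finset.sum_sub_distrib, h]
  have := M.α_pos.ne'
  rw [mul_sub]
  congr 1
  change 1 = 1 / M.α * M.α
  field_simp

theorem excess_nonneg {x : Fin (Q + 1) → Fin (A + 1) → Fin (S + 1) → ℝ}
    (hx : x ∈ M.frequencies) (q : Fin (Q + 1)) (a : Fin (A + 1)) (s : Fin (S + 1)) :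
    0 ≤ (((q : ℕ) : ℝ) - ((a : ℕ) : ℝ)) * x q a s := by
  rcases Nat.lt_or_ge (q : ℕ) a with h | h
  · rw [M.frequencies_eq_zero_of_lt hx h, mul_zero]
  · exact mul_nonneg (sub_nonneg.2 (by exact_mod_cast h)) (hx.1 q a s)

theorem one_le_delay {p : ℝ × ℝ} (hp : p ∈ M.region) : 1 ≤ p.2 := by
  obtain ⟨x, hx, -, hp2⟩ := hp
  have h := M.delay_sub_one hx
  rw [← hp2] at h
  have : 0 ≤ p.2 - 1 := h ▸ mul_nonneg (one_div_nonneg.2 M.α_pos.le)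
    (Finset.sum_nonneg fun q _ => Finset.sum_nonneg fun a _ => Finset.sum_nonneg fun s _ =>
      M.excess_nonneg hx q a s)
  linarith

/-- Delay one forces the rate to equal the number of packets that just arrived. -/
theorem power_eq_of_delay_eq_one {p : ℝ × ℝ} (hp : p ∈ M.region) (h : p.2 = 1) :
    p.1 = ∑ a : Fin (A + 1), M.power ⟨a, by have := M.A_le_S; omega⟩ * M.φ a := by
  obtain ⟨x, hx, hp1, hp2⟩ := hp
  have hS := M.A_le_S
  have hd := M.delay_sub_one hx
  rw [← hp2, h, sub_self, eq_comm, mul_eq_zero_iff_left (one_div_ne_zero M.α_pos.ne'),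
    Finset.sum_eq_zero_iff_of_nonneg fun q _ => Finset.sum_nonneg fun a _ =>
      Finset.sum_nonneg fun s _ => M.excess_nonneg hx q a s] at hd
  have hne : ∀ (q : Fin (Q + 1)) (a : Fin (A + 1)) s, (q : ℕ) ≠ a → x q a s = 0 := by
    intro q a s hqa
    have h1 := hd q (Finset.mem_univ q)
    rw [Finset.sum_eq_zero_iff_of_nonneg fun a _ =>
      Finset.sum_nonneg fun s _ => M.excess_nonneg hx q a s] at h1
    have h2 := h1 a (Finset.mem_univ a)
    rw [Finset.sum_eq_zero_iff_of_nonneg fun s _ => M.excess_nonneg hx q a s] at h2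
    refine (mul_eq_zero.1 (h2 s (Finset.mem_univ s))).resolve_left ?_
    exact sub_ne_zero.2 (by exact_mod_cast hqa)
  rw [hp1, ← M.sum_frequencies_mul hx]
  refine Finset.sum_congr rfl fun q _ => Finset.sum_congr rfl fun a _ =>
    Finset.sum_congr rfl fun s _ => ?_
  by_cases hqa : (q : ℕ) = a
  swap
  · simp [hne q a s hqa]
  by_cases hsa : (s : ℕ) = a
  · congr 2
    exact Fin.ext hsa
  -- Here `s < q`, so some packets stay and the next queue exceeds its arrivals. Such states carry
  -- no mass, so by balance neither does `(q, a, s)`.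
  suffices x q a s = 0 by simp [this]
  obtain ⟨h0, hf, -, hb⟩ := hx
  by_cases hs : Feasible A q s
  swap
  · exact hf q a s hs
  obtain ⟨a', -, ha'⟩ := Finset.exists_ne_zero_of_sum_ne_zero
    (by rw [M.γ_sum a]; exact one_ne_zero : ∑ a', M.γ a a' ≠ 0)
  have hz := hb (nextQueue q s a') a'
  rw [Finset.sum_eq_zero (s := Finset.univ) (f := fun t => x (nextQueue q s a') a' t)
    fun t _ => hne _ _ t ?_] at hz
  · have hterm : ∀ i j k, 0 ≤ M.γ j a' * x i j k *
        (if nextQueue q s a' = nextQueue i k a' then 1 else 0) := fun i j k =>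
      mul_nonneg (mul_nonneg (M.γ_nonneg j a') (h0 i j k)) (by split_ifs <;> simp)
    rw [Finset.sum_eq_zero_iff_of_nonneg fun i _ => Finset.sum_nonneg fun j _ =>
      Finset.sum_nonneg fun k _ => hterm i j k] at hz
    have h1 := hz q (Finset.mem_univ q)
    rw [Finset.sum_eq_zero_iff_of_nonneg fun j _ => Finset.sum_nonneg fun k _ => hterm q j k] at h1
    have h2 := h1 a (Finset.mem_univ a)
    rw [Finset.sum_eq_zero_iff_of_nonneg fun k _ => hterm q a k] at h2
    have h3 := h2 s (Finset.mem_univ s)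
    simpa [ha'] using h3
  · rw [nextQueue_val hs]
    have := hs.2
    omega

theorem trans_ratePolicy {σ : State Q A → Fin (S + 1)} (hσ : ∀ x, Feasible A x.1 (σ x))
    (x y : State Q A) : M.trans (ratePolicy σ hσ) x y =
      M.γ x.2 y.2 * (if y.1 = nextQueue x.1 (σ x) y.2 then 1 else 0) := by
  simp only [trans, ratePolicy, mul_ite, mul_one, mul_zero]
  rw [Finset.sum_eq_single (σ x) (fun s _ hs => by simp [hs]) (by simp)]
  simp

/-- Send the whole queue, up to `S`. The law of `(a, a)` with `a` drawn from `φ` is then stationary.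
-/
theorem exists_delay_eq_one : ∃ p ∈ M.region, p.2 = 1 := by
  have hS := M.A_le_S; have hQ := M.A_le_Q
  let σ : State Q A → Fin (S + 1) := fun x => ⟨min x.1 S, by omega⟩
  have hσ : ∀ x, Feasible A x.1 (σ x) := fun x => ⟨by simp [σ]; omega, by simp [σ]⟩
  let e : Fin (A + 1) → Fin (Q + 1) := fun a => ⟨a, by omega⟩
  let o : State Q A → ℝ := fun x => if x.1 = e x.2 then M.φ x.2 else 0
  have hsum : ∀ h : State Q A → ℝ, ∑ x, o x * h x = ∑ a, M.φ a * h (e a, a) := by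
    intro h
    simp [o, Fintype.sum_prod_type_right]
  have hnext : ∀ a a', nextQueue (e a) (σ (e a, a)) a' = e a' := by
    intro a a'
    ext
    simp only [nextQueue, σ, e]
    omega
  have ho : M.IsStationary (ratePolicy σ hσ) o := by
    refine ⟨fun y => ?_, ?_, fun z => ?_⟩
    · simp only [o]
      split_ifs
      · exact M.φ_nonneg _
      · exact le_rfl
    · have := hsum fun _ => 1
      simpa [M.φ_sum] using this
    · rw [hsum fun y => M.trans (ratePolicy σ hσ) y z]
      simp only [M.trans_ratePolicy hσ, hnext, ← mul_assoc, ← Finset.sum_mul, M.φ_stationary]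
      simp [o]
  refine ⟨_, ho.averages_mem_region, ?_⟩
  simp only [averages]
  rw [hsum fun y => 1 / M.α * ((y.1 : ℕ) : ℝ)]
  have h1 : ∑ a, M.φ a * (1 / M.α * ((e a : ℕ) : ℝ)) = 1 / M.α * M.α := by
    conv_rhs => rw [α, Finset.mul_sum]
    exact Finset.sum_congr rfl fun a _ => by simp only [α, e]; ring
  rw [h1, one_div_mul_cancel M.α_pos.ne']

theorem eq_of_delay_le {v : ℝ × ℝ} (hv : v ∈ M.region) (hmin : ∀ p ∈ M.region, v.2 ≤ p.2)
    {p : ℝ × ℝ} (hp : p ∈ M.region) (h : p.2 ≤ v.2) : p = v := by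
  obtain ⟨r, hr, hr1⟩ := M.exists_delay_eq_one
  have h1 := hmin r hr
  have h2 := M.one_le_delay hp
  have h3 := M.one_le_delay hv
  have hp1 : p.2 = 1 := by linarith
  have hv1 : v.2 = 1 := by linarith
  exact Prod.ext ((M.power_eq_of_delay_eq_one hp hp1).trans
    (M.power_eq_of_delay_eq_one hv hv1).symm) (hp1.trans hv1.symm)

/-! ### Supporting lines at a vertex -/

/-- No region point is strictly better than `v` in both coordinates, so the open quadrant below `v`
can be separated from the region. -/
theorem exists_support {v : ℝ × ℝ} (hv : v ∈ M.tradeoffCurve) :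
    ∃ m c : ℝ, 0 ≤ m ∧ 0 ≤ c ∧ 0 < m + c ∧
      ∀ p ∈ M.region, m * v.1 + c * v.2 ≤ m * p.1 + c * p.2 := by
  obtain ⟨hvR, hpar⟩ := hv
  obtain ⟨f, u, h1, h2⟩ := geometric_hahn_banach_open
    ((convex_Iio v.1).prod (convex_Iio v.2)) (isOpen_Iio.prod isOpen_Iio) M.convex_region
    (Set.disjoint_left.2 fun p hp hpR => by
      rcases hpar p hpR with h | h
      · exact absurd hp.1 (not_lt.2 h)
      · exact absurd hp.2 (not_lt.2 h))
  have hu := h2 v hvR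
  have hpos : ∀ t r : ℝ, 0 < t → 0 < r → f v < u + (f (1, 0) * t + f (0, 1) * r) := by
    intro t r ht hr
    have := h1 (v.1 - t, v.2 - r) ⟨by simpa using ht, by simpa using hr⟩
    rw [linear_apply_prod] at this ⊢
    simp only at this
    linarith
  generalize hm : f (1, 0) = m at hpos
  generalize hc : f (0, 1) = c at hpos
  have hmc : 0 < m + c := by
    have := hpos 1 1 one_pos one_pos
    linarith
  have hle : f v ≤ u := by
    refine le_of_forall_pos_lt_add fun ε hε => ?_
    have := hpos (ε / (m + c)) (ε / (m + c)) (by positivity) (by positivity)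
    rwa [← add_mul, mul_div_cancel₀ _ hmc.ne'] at this
  have key : ∀ t r : ℝ, 0 < t → 0 < r → 0 < m * t + c * r := fun t r ht hr => by
    have := hpos t r ht hr
    linarith
  refine ⟨m, c, ?_, ?_, hmc, fun p hp => ?_⟩
  · by_contra! hneg
    -- With this `t` the form equals `-(|c| + 1) + c < 0`.
    have := key ((|c| + 1) / (-m)) 1 (div_pos (by positivity) (by linarith)) one_pos
    rw [mul_div_assoc', div_neg, mul_div_cancel_left₀ _ hneg.ne] at this
    have := le_abs_self c
    linarith
  · by_contra! hneg
    have := key 1 ((|m| + 1) / (-c)) one_pos (div_pos (by positivity) (by linarith))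
    rw [mul_div_assoc', div_neg, mul_div_cancel_left₀ _ hneg.ne] at this
    have := le_abs_self m
    linarith
  · have := h2 p hp
    rw [linear_apply_prod f v, hm, hc] at hle
    rw [linear_apply_prod f p, hm, hc] at this
    linarith

/-- A point together with an open half-plane bounded by a line through it is convex. -/
theorem lt_of_mem_convexHull {E : Set (ℝ × ℝ)} {v : ℝ × ℝ} {m c : ℝ}
    (h : ∀ e ∈ E, e ≠ v → m * v.1 + c * v.2 < m * e.1 + c * e.2) {p : ℝ × ℝ}
    (hp : p ∈ convexHull ℝ E) (hne : p ≠ v) : m * v.1 + c * v.2 < m * p.1 + c * p.2 := by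
  have hsub : convexHull ℝ E ⊆ {p | p = v ∨ m * v.1 + c * v.2 < m * p.1 + c * p.2} := by
    refine convexHull_min (fun e he => or_iff_not_imp_left.2 (h e he)) ?_
    intro x hx y hy t r ht hr htr
    have hr' : r = 1 - t := by linarith
    have hx' : m * v.1 + c * v.2 ≤ m * x.1 + c * x.2 := by
      rcases hx with rfl | hx
      exacts [le_rfl, hx.le]
    have hy' : m * v.1 + c * v.2 ≤ m * y.1 + c * y.2 := by
      rcases hy with rfl | hy
      exacts [le_rfl, hy.le]
    rcases ht.eq_or_lt with rfl | ht
    · simpa [hr'] using hy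
    rcases hr.eq_or_lt with rfl | hr
    · have : t = 1 := by linarith
      simpa [this] using hx
    simp only [Set.mem_ofPred_eq, Prod.fst_add, Prod.snd_add, Prod.smul_fst, Prod.smul_snd,
      smul_eq_mul] at hx hy ⊢
    rcases hx with rfl | hx
    · rcases hy with rfl | hy
      · left
        rw [← add_smul, htr, one_smul]
      · right
        have := mul_lt_mul_of_pos_left hy hr
        rw [hr'] at this ⊢
        linarith
    · right
      have := mul_lt_mul_of_pos_left hx ht
      have := mul_le_mul_of_nonneg_left hy' hr.le
      rw [hr'] at this ⊢
      linarith
  exact (hsub hp).resolve_left hne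

/-- A vertex of the polygon is exposed. -/
theorem exists_strict_support {v : ℝ × ℝ} (hv : v ∈ M.region.extremePoints ℝ) :
    ∃ m c : ℝ, ∀ p ∈ M.region, p ≠ v → m * v.1 + c * v.2 < m * p.1 + c * p.2 := by
  obtain ⟨E, hE, hR⟩ := M.exists_finite_region_eq_convexHull
  have hnot : v ∉ convexHull ℝ (E \ {v}) := fun h =>
    (M.convex_region.mem_extremePoints_iff_mem_sdiff_convexHull_sdiff.1 hv).2
      (convexHull_mono (Set.sdiff_subset_sdiff_left (hR ▸ subset_convexHull ℝ E)) h)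
  obtain ⟨f, u, h1, h2⟩ := geometric_hahn_banach_point_closed (convex_convexHull ℝ _)
    (hE.sdiff.isClosed_convexHull ℝ) hnot
  refine ⟨f (1, 0), f (0, 1), fun p hp hne =>
    lt_of_mem_convexHull (fun e he hev => ?_) (hR ▸ hp) hne⟩
  rw [← linear_apply_prod, ← linear_apply_prod]
  exact h1.trans (h2 e (subset_convexHull ℝ _ ⟨he, hev⟩))

/-- A lexicographically positive pair stays positive under small tilts; over a finite set one `ε`
serves all points. -/
theorem eventually_add_mul_pos {a b : ℝ} (h : 0 < a ∨ a = 0 ∧ 0 < b) :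
    ∀ᶠ ε in 𝓝[>] (0 : ℝ), 0 < a + ε * b := by
  rcases h with h | ⟨rfl, h⟩
  · have hc : Tendsto (fun ε : ℝ => a + ε * b) (𝓝[>] 0) (𝓝 (a + 0 * b)) :=
      (Continuous.tendsto (by fun_prop) 0).mono_left nhdsWithin_le_nhds
    exact hc.eventually_const_lt (by simpa using h)
  · filter_upwards [self_mem_nhdsWithin] with ε hε
    rw [zero_add]
    exact mul_pos hε h

/-- A vertex of the tradeoff curve is the only minimizer of a functional with nonnegative weight of
the power. -/
theorem exists_nonneg_strict_support {v : ℝ × ℝ} (hv : M.IsVertex v) :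
    ∃ m c : ℝ, 0 ≤ m ∧ ∀ p ∈ M.region, p ≠ v → m * v.1 + c * v.2 < m * p.1 + c * p.2 := by
  obtain ⟨m, c, hm, hc, hmc, hle⟩ := M.exists_support hv.1
  rcases hm.eq_or_lt with rfl | hm
  · refine ⟨0, 1, le_rfl, fun p hp hne => ?_⟩
    by_contra! h
    refine hne (M.eq_of_delay_le hv.1.1 (fun p hp => ?_) hp (by linarith))
    have := hle p hp
    rw [zero_mul, zero_mul, zero_add, zero_add] at this
    exact le_of_mul_le_mul_left this (by linarith)
  · obtain ⟨m', c', hlt⟩ := M.exists_strict_support hv.2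
    obtain ⟨ε, h1, h2⟩ := ((eventually_add_mul_pos (b := m') (.inl hm)).and
      self_mem_nhdsWithin).exists
    refine ⟨m + ε * m', c + ε * c', h1.le, fun p hp hne => ?_⟩
    have := hle p hp
    have := mul_lt_mul_of_pos_left (hlt p hp hne) h2
    linarith

/-- A vertex that has the least delay for its power is the only minimizer of some `D + μ P`. -/
theorem exists_multiplier {v : ℝ × ℝ} (hv : M.IsVertex v)
    (hmin : ∀ p ∈ M.region, p.1 ≤ v.1 → v.2 ≤ p.2) :
    ∃ μ : ℝ, 0 < μ ∧ ∀ p ∈ M.region, p ≠ v → v.2 + μ * v.1 < p.2 + μ * p.1 := by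
  suffices ∃ m c : ℝ, 0 < m ∧ 0 < c ∧
      ∀ p ∈ M.region, p ≠ v → m * v.1 + c * v.2 < m * p.1 + c * p.2 by
    obtain ⟨m, c, hm, hc, h⟩ := this
    refine ⟨m / c, div_pos hm hc, fun p hp hne => ?_⟩
    have := div_lt_div_of_pos_right (h p hp hne) hc
    rw [add_div, add_div, mul_div_cancel_left₀ _ hc.ne', mul_div_cancel_left₀ _ hc.ne'] at this
    rw [div_mul_eq_mul_div, div_mul_eq_mul_div]
    linarith
  obtain ⟨m, c, hm, hc, hmc, hle⟩ := M.exists_support hv.1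
  obtain ⟨E, hE, hR⟩ := M.exists_finite_region_eq_convexHull
  have hER : E ⊆ M.region := hR ▸ subset_convexHull ℝ E
  rcases hm.eq_or_lt with rfl | hm
  -- Zero weight on power: `v` is the only point of least delay, so a small weight on power is
  -- harmless.
  · have hlt : ∀ e ∈ E, ∀ᶠ ε in 𝓝[>] (0 : ℝ), e ≠ v → 0 < (e.2 - v.2) + ε * (e.1 - v.1) := by
      intro e he
      by_cases hne : e = v
      · simp [hne]
      refine (eventually_add_mul_pos (.inl ?_)).mono fun ε h _ => h
      by_contra! h
      refine hne (M.eq_of_delay_le hv.1.1 (fun p hp => ?_) (hER he) (by linarith))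
      have := hle p hp
      rw [zero_mul, zero_mul, zero_add, zero_add] at this
      exact le_of_mul_le_mul_left this (by linarith)
    obtain ⟨ε, h1, h2⟩ := ((hE.eventually_all.2 hlt).and self_mem_nhdsWithin).exists
    refine ⟨ε, 1, h2, one_pos, fun p hp hne =>
      lt_of_mem_convexHull (fun e he hev => ?_) (hR ▸ hp) hne⟩
    have := h1 e he hev
    linarith
  rcases hc.eq_or_lt with rfl | hc
  -- Zero weight on delay: `v` has least power, and `hmin` breaks ties, so `v` is lexicographically
  -- least.
  · have hle1 : ∀ p ∈ M.region, v.1 ≤ p.1 := fun p hp => by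
      have := hle p hp
      rw [zero_mul, zero_mul, add_zero, add_zero] at this
      exact le_of_mul_le_mul_left this hm
    have hlt : ∀ e ∈ E, ∀ᶠ ε in 𝓝[>] (0 : ℝ), e ≠ v → 0 < (e.1 - v.1) + ε * (e.2 - v.2) := by
      intro e he
      by_cases hne : e = v
      · simp [hne]
      refine (eventually_add_mul_pos ?_).mono fun ε h _ => h
      rcases (hle1 e (hER he)).eq_or_lt with h | h
      · refine .inr ⟨by linarith, sub_pos.2 (lt_of_le_of_ne (hmin e (hER he) h.ge) fun h' => ?_)⟩
        exact hne (Prod.ext h.symm h'.symm)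
      · exact .inl (sub_pos.2 h)
    obtain ⟨ε, h1, h2⟩ := ((hE.eventually_all.2 hlt).and self_mem_nhdsWithin).exists
    refine ⟨1, ε, one_pos, h2, fun p hp hne =>
      lt_of_mem_convexHull (fun e he hev => ?_) (hR ▸ hp) hne⟩
    have := h1 e he hev
    linarith
  · obtain ⟨m', c', hlt⟩ := M.exists_strict_support hv.2
    obtain ⟨ε, ⟨h1, h2⟩, h3⟩ := (((eventually_add_mul_pos (b := m') (.inl hm)).and
      (eventually_add_mul_pos (b := c') (.inl hc))).and self_mem_nhdsWithin).exists
    refine ⟨m + ε * m', c + ε * c', h1, h2, fun p hp hne => ?_⟩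
    have := hle p hp
    have := mul_lt_mul_of_pos_left (hlt p hp hne) h3
    linarith

/-! ### Thresholds -/

/-- By monotonicity `{q | σ (q, a) ≤ s}` is an initial segment. Its last element, its cardinality
minus one, is the threshold, and the empty segment gives -1. -/
theorem exists_thresholds {σ : State Q A → Fin (S + 1)} (hσ : ∀ x, Feasible A x.1 (σ x))
    (hmono : ∀ (q q' : Fin (Q + 1)) (a : Fin (A + 1)), q ≤ q' → σ (q, a) ≤ σ (q', a)) :
    ∃ th : ℤ → Fin (A + 1) → ℤ, (ratePolicy σ hσ).HasThresholds th := by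
  classical
  let B : ℤ → Fin (A + 1) → Finset (Fin (Q + 1)) := fun s a =>
    Finset.univ.filter fun q => ((σ (q, a) : ℕ) : ℤ) ≤ s
  have hB : ∀ s a q, q ∈ B s a ↔ ((σ (q, a) : ℕ) : ℤ) ≤ s := fun s a q => by simp [B]
  have key : ∀ (s : ℤ) (a : Fin (A + 1)) (q : Fin (Q + 1)),
      ((q : ℕ) : ℤ) ≤ ((B s a).card : ℤ) - 1 ↔ ((σ (q, a) : ℕ) : ℤ) ≤ s := by
    intro s a q
    constructor
    · intro h
      by_contra hlt
      have hsub : B s a ⊆ Finset.Iio q := fun r hr => by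
        rw [Finset.mem_Iio]
        by_contra hqr
        have := Fin.le_def.1 (hmono q r a (not_lt.1 hqr))
        have := (hB s a r).1 hr
        omega
      have := Finset.card_le_card hsub
      rw [Fin.card_Iio] at this
      omega
    · intro h
      have hsub : Finset.Iic q ⊆ B s a := fun r hr => by
        have := Fin.le_def.1 (hmono r q a (Finset.mem_Iic.1 hr))
        exact (hB s a r).2 (by omega)
      have := Finset.card_le_card hsub
      rw [Fin.card_Iic] at this
      omega
  refine ⟨fun s a => ((B s a).card : ℤ) - 1, fun a => ⟨?_, ?_, ?_, fun s _ _ => ?_⟩,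
    fun q a s => ?_⟩
  · have : B (-1) a = ∅ := Finset.eq_empty_of_forall_notMem fun q hq => by
      have := (hB _ _ _).1 hq
      omega
    simp [this]
  · have h := (key 0 a 0).2 (by have := (hσ (0, a)).2; simp only [Fin.val_zero] at this; omega)
    simpa using h
  · have := Finset.card_le_univ (B S a)
    rw [Fintype.card_fin] at this
    simp only
    omega
  · have : B s a ⊆ B (s + 1) a := fun q hq => by
      have := (hB _ _ _).1 hq
      exact (hB _ _ _).2 (by omega)
    have := Finset.card_le_card this
    simp only
    omega
  · have h : (((B (((s : ℕ) : ℤ) - 1) a).card : ℤ) - 1 < (q : ℕ) ∧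
        ((q : ℕ) : ℤ) ≤ ((B (s : ℕ) a).card : ℤ) - 1) ↔ s = σ (q, a) := by
      rw [← not_le, key, key, Fin.ext_iff]
      omega
    exact ⟨fun hs => if_pos (h.1 hs), fun hs => if_neg fun e => hs (h.2 e)⟩

/-! ### Closed classes -/

/-- A reachable set of least cardinality is reachable in full from each of its members. -/
theorem exists_isClosedClass (F : Policy Q A S) : ∃ C, M.IsClosedClass F C := by
  obtain ⟨x, -, hx⟩ := Finset.exists_min_image Finset.univ
    (fun x : State Q A => {y | M.Reaches F x y}.ncard) Finset.univ_nonempty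
  refine ⟨{y | M.Reaches F x y}, ⟨x, .refl⟩, fun z hz y => ?_⟩
  have hsub : {y | M.Reaches F z y} ⊆ {y | M.Reaches F x y} := fun y hy =>
    Relation.ReflTransGen.trans hz hy
  rw [← Set.eq_of_subset_of_ncard_le hsub (hx z (Finset.mem_univ z))]
  rfl

/-- Expected queue length after `n` slots. -/
noncomputable def expectedQueue (F : Policy Q A S) (n : ℕ) (x : State Q A) : ℝ :=
  ∑ y, (M.trans F ^ n) x y * ((y.1 : ℕ) : ℝ)

theorem expectedQueue_succ {σ : State Q A → Fin (S + 1)} (hσ : ∀ x, Feasible A x.1 (σ x))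
    (n : ℕ) (x : State Q A) : M.expectedQueue (ratePolicy σ hσ) (n + 1) x =
      ∑ a', M.γ x.2 a' *
        M.expectedQueue (ratePolicy σ hσ) n (nextQueue x.1 (σ x) a', a') := by
  rw [← M.sum_trans_ratePolicy_mul hσ]
  simp only [expectedQueue, pow_succ', Matrix.mul_apply, Finset.sum_mul, Finset.mul_sum]
  rw [Finset.sum_comm]
  exact Finset.sum_congr rfl fun y _ => Finset.sum_congr rfl fun z _ => by ring

/-- `C` is closed under the transitions of the deterministic policy with rates `σ`. -/
def ClosedUnder (σ : State Q A → Fin (S + 1)) (C : Set (State Q A)) : Prop :=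
  ∀ x ∈ C, ∀ a', 0 < M.γ x.2 a' → (nextQueue x.1 (σ x) a', a') ∈ C

theorem IsClosedClass.closedUnder {σ : State Q A → Fin (S + 1)}
    {hσ : ∀ x, Feasible A x.1 (σ x)} {C : Set (State Q A)}
    (h : M.IsClosedClass (ratePolicy σ hσ) C) : M.ClosedUnder σ C := by
  intro x hx a' ha'
  refine (h.2 x hx _).2 (.single ?_)
  simpa [M.trans_ratePolicy hσ] using ha'

/-- The arrivals evolve independently of the rates, so a nonempty closed set meets every arrival
value. -/
theorem ClosedUnder.exists_mem {σ : State Q A → Fin (S + 1)} {C : Set (State Q A)}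
    (h : M.ClosedUnder σ C) {x : State Q A} (hx : x ∈ C) (b : Fin (A + 1)) :
    ∃ q, (q, b) ∈ C := by
  induction M.reflTransGen_arrivals x.2 b with
  | refl => exact ⟨x.1, hx⟩
  | tail _ hbc ih =>
    obtain ⟨q, hq⟩ := ih
    exact ⟨_, h _ hq _ hbc⟩

/-- Couple the two chains through common arrivals. Monotone remainders keep the order, monotone
rates keep the gap at most `d`, and `hgap` keeps it at least `d`. -/
theorem expectedQueue_gap {σ : State Q A → Fin (S + 1)} (hσ : ∀ x, Feasible A x.1 (σ x))
    (hmono : ∀ (q q' : Fin (Q + 1)) (a : Fin (A + 1)), q ≤ q' →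
      (σ (q, a) : ℕ) ≤ σ (q', a) ∧ (σ (q', a) : ℕ) + q ≤ σ (q, a) + q')
    {C C' : Set (State Q A)} (hC : M.ClosedUnder σ C) (hC' : M.ClosedUnder σ C') {d : ℕ}
    (hd : 0 < d) (hgap : ∀ (q q' : Fin (Q + 1)) (a : Fin (A + 1)), (q, a) ∈ C → (q', a) ∈ C' →
      d ≤ ((q' : ℕ) - q) + (q - q')) (n : ℕ) {q q' : Fin (Q + 1)} {a : Fin (A + 1)}
    (hq : (q, a) ∈ C) (hq' : (q', a) ∈ C') (h : (q' : ℕ) = q + d) :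
    M.expectedQueue (ratePolicy σ hσ) n (q', a) =
      M.expectedQueue (ratePolicy σ hσ) n (q, a) + d := by
  induction n generalizing q q' a with
  | zero => simp [expectedQueue, Matrix.one_apply, h]
  | succ n ih =>
    have e : (d : ℝ) = ∑ a', M.γ a a' * d := by rw [← Finset.sum_mul, M.γ_sum, one_mul]
    rw [expectedQueue_succ, expectedQueue_succ, e, ← Finset.sum_add_distrib]
    refine Finset.sum_congr rfl fun a' _ => ?_
    rw [← mul_add]
    rcases (M.γ_nonneg a a').eq_or_lt with h0 | h0
    · simp [← h0]
    · congr 1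
      have m := hC _ hq a' h0
      have m' := hC' _ hq' a' h0
      refine ih m m' ?_
      have hg := hgap _ _ _ m m'
      have k := hmono q q' a (Fin.le_def.2 (by omega))
      have f := (hσ (q, a)).2
      have f' := (hσ (q', a)).2
      simp only [nextQueue_val (hσ (q, a)), nextQueue_val (hσ (q', a))] at hg ⊢
      simp only at f f'
      omega

theorem meanDelay_eq (F : Policy Q A S) (x : State Q A) (N : ℕ) :
    M.meanDelay F x N =
      (1 / (N : ℝ)) * ∑ n ∈ Finset.Icc 1 N, (1 / M.α) * M.expectedQueue F n x := by
  simp only [meanDelay, expectedQueue, Finset.mul_sum]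
  exact Finset.sum_congr rfl fun n _ => Finset.sum_congr rfl fun y _ => by ring

/-- When rates and packets left over are nondecreasing in the queue length and the mean delay does
not depend on the initial state, there is only one closed class. -/
theorem isUnichain_ratePolicy {σ : State Q A → Fin (S + 1)} (hσ : ∀ x, Feasible A x.1 (σ x))
    (hmono : ∀ (q q' : Fin (Q + 1)) (a : Fin (A + 1)), q ≤ q' →
      (σ (q, a) : ℕ) ≤ σ (q', a) ∧ (σ (q', a) : ℕ) + q ≤ σ (q, a) + q')
    {v : ℝ × ℝ} (hav : ∀ x, M.HasAverages (ratePolicy σ hσ) x v) :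
    M.IsUnichain (ratePolicy σ hσ) := by
  obtain ⟨C, hC⟩ := M.exists_isClosedClass (ratePolicy σ hσ)
  refine ⟨C, hC, fun C' hC' => ?_⟩
  by_contra hne
  have hdisj : ∀ z, z ∈ C → z ∉ C' := fun z hz hz' =>
    hne (Set.ext fun y => (hC'.2 z hz' y).trans (hC.2 z hz y).symm)
  have k := hC.closedUnder
  have k' := hC'.closedUnder
  obtain ⟨x, hx⟩ := hC.1
  obtain ⟨x', hx'⟩ := hC'.1
  obtain ⟨q₀, hq₀⟩ := k.exists_mem M hx 0
  obtain ⟨q₀', hq₀'⟩ := k'.exists_mem M hx' 0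
  -- The sum of truncated differences is the absolute difference; a closest pair with equal arrivals
  -- is chosen.
  have hex : ∃ d : ℕ, ∃ (q q' : Fin (Q + 1)) (a : Fin (A + 1)), (q, a) ∈ C ∧ (q', a) ∈ C' ∧
      d = ((q' : ℕ) - q) + (q - q') := ⟨_, q₀, q₀', 0, hq₀, hq₀', rfl⟩
  classical
  obtain ⟨q, q', a, hq, hq', hd⟩ := Nat.find_spec hex
  have hgap : ∀ (q q' : Fin (Q + 1)) (a : Fin (A + 1)), (q, a) ∈ C → (q', a) ∈ C' →
      Nat.find hex ≤ ((q' : ℕ) - q) + (q - q') := fun q q' a h h' =>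
    Nat.find_min' hex ⟨q, q', a, h, h', rfl⟩
  generalize Nat.find hex = d at *
  have hqq : (q : ℕ) ≠ q' := fun e => hdisj _ hq (by rw [Fin.ext e]; exact hq')
  have hd0 : 0 < d := by omega
  -- A permanent gap `d` separates the mean delays by `d / α > 0`, though both tend to `v.2`.
  have contra : ∀ r r' : Fin (Q + 1), (∀ n, M.expectedQueue (ratePolicy σ hσ) n (r', a) =
      M.expectedQueue (ratePolicy σ hσ) n (r, a) + d) → False := by
    intro r r' h
    have hlim := (hav (r, a)).2.add_const ((1 / M.α) * (d : ℝ))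
    have hα := M.α_pos
    have heq := tendsto_nhds_unique (hav (r', a)).2 (hlim.congr' ?_)
    · have : 0 < 1 / M.α * (d : ℝ) := by positivity
      linarith
    · filter_upwards [eventually_ne_atTop 0] with N hN
      have hN' : (N : ℝ) ≠ 0 := by exact_mod_cast hN
      simp only [meanDelay_eq, h, mul_add, Finset.sum_add_distrib, Finset.sum_const,
        Nat.card_Icc, Nat.add_sub_cancel, nsmul_eq_mul]
      field_simp
  rcases Nat.lt_or_ge (q : ℕ) q' with hlt | hge
  · exact contra q q' fun n => M.expectedQueue_gap hσ hmono k k' hd0 hgap n hq hq' (by omega)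
  · exact contra q' q fun n => M.expectedQueue_gap hσ hmono k' k hd0
      (fun r r' b h h' => by have := hgap r' r b h' h; omega) n hq' hq (by omega)

theorem monotone_of_consecutive {σ : State Q A → Fin (S + 1)}
    (h : ∀ (q q' : Fin (Q + 1)) (a : Fin (A + 1)), (q' : ℕ) = q + 1 →
      (σ (q, a) : ℕ) ≤ σ (q', a) ∧ (σ (q', a) : ℕ) ≤ σ (q, a) + 1)
    (q q' : Fin (Q + 1)) (a : Fin (A + 1)) (hq : q ≤ q') :
    (σ (q, a) : ℕ) ≤ σ (q', a) ∧ (σ (q', a) : ℕ) + q ≤ σ (q, a) + q' := by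
  obtain ⟨d, hd⟩ := Nat.exists_eq_add_of_le (Fin.le_def.1 hq)
  induction d generalizing q' with
  | zero =>
    have : q' = q := Fin.ext (by omega)
    subst this
    exact ⟨le_rfl, le_rfl⟩
  | succ d ih =>
    have h1 := ih ⟨q + d, by omega⟩ (Fin.le_def.2 (by simp)) rfl
    have h2 := h ⟨q + d, by omega⟩ q' a (by simp; omega)
    simp only at h1
    omega

end LinkModel

theorem theorem5 {Q A S : ℕ} (M : LinkModel Q A S) (v : ℝ × ℝ) (hv : M.IsVertex v) :
    (∃ F : LinkModel.Policy Q A S,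
      F.IsDeterministic ∧
      (∃ th : ℤ → Fin (A + 1) → ℤ, F.HasThresholds th) ∧
      M.IsUnichain F ∧
      (∀ x, M.HasAverages F x v) ∧
      (∀ μ : ℝ, 0 < μ → (∀ p ∈ M.region, v.2 + μ * v.1 ≤ p.2 + μ * p.1) →
        M.IsLagrangeOptimal μ F)) ∧
    ((∀ p ∈ M.region, p.1 ≤ v.1 → v.2 ≤ p.2) →
      ∃ μ : ℝ, 0 < μ ∧ ∀ p ∈ M.region, p ≠ v → v.2 + μ * v.1 < p.2 + μ * p.1) := by
  refine ⟨?_, M.exists_multiplier hv⟩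
  obtain ⟨m, c, hm, hlt⟩ := M.exists_nonneg_strict_support hv
  obtain ⟨g, σ, hσ, hge, hst, hcons⟩ := M.exists_optimal_rates m c
  have hmono := LinkModel.monotone_of_consecutive (hcons hm)
  have hav : ∀ x, M.HasAverages (LinkModel.ratePolicy σ hσ) x v := by
    -- Stationary averages have value `g`, which is at most the value at `v`; strict support leaves
    -- only `v`.
    refine M.hasAverages_of_forall_stationary fun o ho => ?_
    by_contra hne
    have h1 := hlt _ ho.averages_mem_region hne
    have h2 := hge v hv.1.1
    have h3 := hst o ho
    linarith
  refine ⟨LinkModel.ratePolicy σ hσ, fun q a => ⟨σ (q, a), if_pos rfl⟩,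
    LinkModel.exists_thresholds hσ fun q q' a h => Fin.le_def.2 (hmono q q' a h).1,
    M.isUnichain_ratePolicy hσ hmono hav, hav, fun μ _ hmin x p hp G y p' hp' => ?_⟩
  have e : p = v := Prod.ext (tendsto_nhds_unique hp.1 (hav x).1)
    (tendsto_nhds_unique hp.2 (hav x).2)
  rw [e]
  exact hmin p' (M.mem_region_of_hasAverages hp')
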